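/- Let $(u_n)_{n\ge0}$ be the sequence of rational numbers with $u_0=1$, $u_1=12$ and $$(n+1)^5u_{n+1}-3(2n+1)(3n^2+3n+1)(15n^2+15n+4)u_n-3n^3(3n-1)(3n+1)u_{n-1}=0\qquad(n\ge1).$$ For real $x,y$ write $\binom xy=\frac{\Gamma(x+1)}{\Gamma(y+1)\Gamma(x-y+1)}$, and let $\frac{\mathrm d}{\mathrm dl}$ denote the derivative with respect to the real variable $l$ (all the derivatives below exist). Then for every integer $n\ge0$ $$ \begin{aligned} (-1)^nu_n &=-\sum_{l=0}^n\frac{\mathrm d}{\mathrm dl}\Bigl(\Bigl(\frac n2-l\Bigr)\binom nl^4\binom{n+l}n^2\binom{2n-l}n^2\Bigr)\\ &=(-1)^n\sum_{i=0}^n(-1)^i\binom{3n+1}i\binom{2n-i}n^2\sum_{j=i}^n\binom{n+j-i}n\binom nj^2\binom{2n-j}n\\ &=(-1)^n\sum_{i=0}^n(-1)^i\binom{n+i}n^3\sum_{j=i}^n(-1)^j\binom{3n+1}{j-i}\binom{2n-j}n^3\\ &=\sum_{i=0}^n\binom ni^2\binom{n+i}n\sum_{j=i}^n(-1)^j\binom{n+j-i}n\binom{n+j}n^2\binom{3n+1}{n-j}\\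 &=(-1)^n\sum_{i=0}^n\binom ni\binom{n+i}n\binom{2n-i}n\sum_{j=i}^n\binom n{j-i}\binom nj\binom{2n-j}n^2\\ &=(-1)^n\sum_{i=0}^n\binom ni\binom{n+i}n^2\sum_{j=i}^n\binom n{j-i}\binom nj\binom{n+j}n\binom{2n-j}n . \end{aligned} $$ In particular every $u_n$ is an integer. -/

import Mathlib

/-- The solution `u` of the recursion
`(m+1)^5 u_{m+1} = 3(2m+1)(3m²+3m+1)(15m²+15m+4) u_m + 3m³(3m-1)(3m+1) u_{m-1}` for `m ≥ 1`,
with `u_0 = 1` and `u_1 = 12`; the last clause is the recursion at `m = k + 1`. -/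
def aperyZetaFour : ℕ → ℚ
  | 0 => 1
  | 1 => 12
  | k + 2 =>
    (3 * (2 * ((k : ℚ) + 1) + 1) * (3 * ((k : ℚ) + 1) ^ 2 + 3 * ((k : ℚ) + 1) + 1)
          * (15 * ((k : ℚ) + 1) ^ 2 + 15 * ((k : ℚ) + 1) + 4) * aperyZetaFour (k + 1)
        + 3 * ((k : ℚ) + 1) ^ 3 * (3 * ((k : ℚ) + 1) - 1) * (3 * ((k : ℚ) + 1) + 1)
          * aperyZetaFour k)
      / (((k : ℚ) + 1) + 1) ^ 5

/-- `aperyZetaFour` satisfies the three-term recursion in its usual form. -/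
theorem aperyZetaFour_rec (m : ℕ) (hm : 1 ≤ m) :
    ((m : ℚ) + 1) ^ 5 * aperyZetaFour (m + 1)
      - 3 * (2 * (m : ℚ) + 1) * (3 * (m : ℚ) ^ 2 + 3 * m + 1) * (15 * (m : ℚ) ^ 2 + 15 * m + 4)
          * aperyZetaFour m
      - 3 * (m : ℚ) ^ 3 * (3 * (m : ℚ) - 1) * (3 * (m : ℚ) + 1) * aperyZetaFour (m - 1) = 0 := by
  obtain ⟨k, rfl⟩ : ∃ k, m = k + 1 := ⟨m - 1, by omega⟩
  have h : ((k : ℚ) + 1 + 1) ≠ 0 := by positivity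
  have e : k + 1 - 1 = k := by omega
  rw [e, aperyZetaFour]
  push_cast
  field_simp
  ring

/-- The binomial coefficient with real entries,
`Γ(x + 1) / (Γ(y + 1) Γ(x - y + 1))`. -/
noncomputable def realBinom (x y : ℝ) : ℝ :=
  Real.Gamma (x + 1) / (Real.Gamma (y + 1) * Real.Gamma (x - y + 1))

theorem realBinom_natCast {n k : ℕ} (h : k ≤ n) : realBinom n k = (n.choose k : ℝ) := by
  rw [realBinom, Nat.cast_choose ℝ h, ← Nat.cast_sub h]
  simp only [Real.Gamma_nat_eq_factorial]

/-- The function `(n/2 - x) * C(n,x)^4 * C(n+x,n)^2 * C(2n-x,n)^2` of a real variable `x`. -/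
noncomputable def zetaFourTerm (n : ℕ) (x : ℝ) : ℝ :=
  ((n : ℝ) / 2 - x) * realBinom n x ^ 4 * realBinom (n + x) n ^ 2 * realBinom (2 * n - x) n ^ 2

section

open Finset Filter Topology
set_option linter.unusedSimpArgs false

/-! At an integer `l ≤ n` the summand equals a rational function of `e = x - l`, namely `wellPoised
n l e`, times `(Γ(1+e)Γ(1-e))⁻⁴`. The Gamma factor is even in `e` with value 1 at 0, so it does not
affect the first derivative. Everything reduces to the sum of the derivatives of `wellPoised n l` at
0.

Double sums: the sixth power in the denominator can be altered to `wellPoised'` without changing the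
derivative at 0. The sum of `wellPoised' n l e` over `l` is then, up to a prefactor with a zero at
`e = 0`, a terminating very-well-poised series with `a = -n+2e`, four parameters `-n+e` and two
parameters `n+1+e`. Three applications of the Bailey lemma to the unit Bailey pair turn it into a
double sum, `baileyDouble`, continuous at `e = 0`. So the sum has the form `e * E e` and its
derivative is `E 0`. The series is symmetric in the six parameters and the double sum is not:
different groupings into three pairs give the five formulas (`neg_sum_deriv_wellPoised`).

Recursion: `wellPoised n l e = e⁴ R(l+e)` for one rational function `R` depending on `n`. Creative
telescoping gives a three-term relation between these functions whose right side is a difference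
`S(x+1) - S(x)`. Summed over `l`, what remains is regular at `e = 0`, and the factor `e⁴`
annihilates its derivative. The values at `n = 1, 2`, read off from a double sum, then identify the
sum with `(-1)^n u_n`; the case `n = 0` is checked separately. -/

/-! ### Rising factorials. -/

/-- The rising factorial `x (x + 1) ⋯ (x + k - 1)`. -/
noncomputable def rise (x : ℝ) (k : ℕ) : ℝ := ∏ i ∈ range k, (x + i)

@[simp] theorem rise_zero (x : ℝ) : rise x 0 = 1 := by simp [rise]

theorem rise_succ (x : ℝ) (k : ℕ) : rise x (k + 1) = rise x k * (x + k) := by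
  simp [rise, prod_range_succ]

theorem rise_succ' (x : ℝ) (k : ℕ) : rise x (k + 1) = x * rise (x + 1) k := by
  rw [rise, prod_range_succ', rise, mul_comm]
  congr 1
  · simp
  · refine prod_congr rfl fun i _ => ?_
    push_cast; ring

theorem rise_add (x : ℝ) (j k : ℕ) : rise x (j + k) = rise x j * rise (x + j) k := by
  induction k with
  | zero => simp
  | succ k ih => rw [← add_assoc, rise_succ, ih, rise_succ]; push_cast; ring

theorem rise_reflect (x : ℝ) (k : ℕ) : rise x k = (-1) ^ k * rise (1 - x - k) k := by
  induction k generalizing x with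
  | zero => simp
  | succ k ih =>
    rw [rise_succ', ih, rise_succ]
    push_cast
    rw [show 1 - (x + 1) - (k : ℝ) = 1 - x - (k + 1) by ring, pow_succ]
    ring

theorem rise_ne_zero {x : ℝ} {k : ℕ} (h : ∀ i < k, x + i ≠ 0) : rise x k ≠ 0 :=
  prod_ne_zero_iff.2 fun i hi => h i (mem_range.1 hi)

theorem rise_pos {x : ℝ} (hx : 0 < x) (k : ℕ) : 0 < rise x k :=
  prod_pos fun i _ => by positivity

theorem rise_one (k : ℕ) : rise 1 k = k.factorial := by
  induction k with
  | zero => simp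
  | succ k ih => rw [rise_succ, ih, Nat.factorial_succ]; push_cast; ring

@[fun_prop]
theorem DifferentiableAt.rise {f : ℝ → ℝ} {x : ℝ} (hf : DifferentiableAt ℝ f x) (k : ℕ) :
    DifferentiableAt ℝ (fun y => rise (f y) k) x := by
  unfold _root_.rise
  fun_prop

@[fun_prop]
theorem ContinuousAt.rise {f : ℝ → ℝ} {x : ℝ} (hf : ContinuousAt f x) (k : ℕ) :
    ContinuousAt (fun y => rise (f y) k) x := by
  unfold _root_.rise
  fun_prop

/-! ### Pfaff–Saalschütz summation and the Bailey lemma. -/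

/-- The Pfaff–Saalschütz summation in polynomial form. -/
theorem sum_choose_mul_rise (A B C : ℝ) (M : ℕ) :
    ∑ k ∈ range (M + 1), (M.choose k : ℝ) * rise B k * rise C k * rise (A - B - C) (M - k)
        * rise (A + k) (M - k)
      = rise (A - B) M * rise (A - C) M := by
  induction M with
  | zero => simp
  | succ M ih =>
    -- WZ method: the expected first-order recursion in `M` holds termwise up to a difference in
    -- `k`. At `m = M` the partial sum is minus the one extra term `k = M + 1` of the longer sum.
    have key : ∀ m ≤ M,
        ∑ k ∈ range (m + 1), (((M + 1).choose k : ℝ) * rise B k * rise C k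
            * rise (A - B - C) (M + 1 - k) * rise (A + k) (M + 1 - k)
          - (A - B + M) * (A - C + M) * ((M.choose k : ℝ) * rise B k * rise C k
            * rise (A - B - C) (M - k) * rise (A + k) (M - k)))
        = -((M.choose m : ℝ) * rise B (m + 1) * rise C (m + 1) * rise (A - B - C) (M - m)
            * rise (A + m) (M - m)) := by
      intro m
      induction m with
      | zero =>
        intro _
        simp [rise_succ]
        ring
      | succ m ihm =>
        intro hm
        obtain ⟨d, rfl⟩ := Nat.exists_eq_add_of_le hm
        rw [sum_range_succ, ihm (by omega)]
        have e1 : m + 1 + d + 1 - (m + 1) = d + 1 := by omega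
        have e2 : m + 1 + d - (m + 1) = d := by omega
        have e3 : m + 1 + d - m = d + 1 := by omega
        have hc : ((m + 1 + d).choose (m + 1) : ℝ) * (m + 1) = (m + 1 + d).choose m * (d + 1) := by
          have := Nat.choose_succ_right_eq (m + 1 + d) m
          rw [e3] at this
          exact_mod_cast this
        have hp : ((m + 1 + d + 1).choose (m + 1) : ℝ)
            = (m + 1 + d).choose m + (m + 1 + d).choose (m + 1) := by
          exact_mod_cast Nat.choose_succ_succ (m + 1 + d) m
        rw [e1, e2, e3, hp, rise_succ' (A + (m : ℝ)) d,
          rise_succ (A - B - C) d, rise_succ B (m + 1), rise_succ C (m + 1),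
          rise_succ (A + ((m + 1 : ℕ) : ℝ)) d]
        push_cast
        rw [show A + (m : ℝ) + 1 = A + (m + 1) by ring]
        linear_combination (rise B (m + 1) * rise C (m + 1) * rise (A - B - C) d
          * rise (A + (m + 1)) d * (-(A - B - C + d))) * hc
    have h := key M le_rfl
    rw [sum_sub_distrib, ← mul_sum, ih] at h
    rw [sum_range_succ, rise_succ (A - B), rise_succ (A - C)]
    simp only [Nat.choose_self, Nat.sub_self, rise_zero, Nat.cast_one] at h ⊢
    linear_combination h

/-- `β` is obtained from `α` by the Bailey transform relative to `a`. -/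
def IsBaileyPair (a : ℝ) (α β : ℕ → ℝ) : Prop :=
  ∀ L, β L = ∑ r ∈ range (L + 1), α r / ((L - r).factorial * rise (1 + a) (L + r))

/-- The starting point of the iteration: `α r` is the usual `(-1)^r (a)_r (1+a/2)_r / ((a/2)_r r!)`,
whose very-well-poised factor `a + 2r` makes the sums telescope. -/
theorem isBaileyPair_unit {a : ℝ} (h : ∀ k : ℕ, a + k ≠ 0) :
    IsBaileyPair a (fun r => (-1) ^ r * (a + 2 * r) * rise (1 + a) r / ((a + r) * r.factorial))
      (fun L => if L = 0 then 1 else 0) := by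
  have hr : ∀ k, rise (1 + a) k ≠ 0 := fun k => rise_ne_zero fun i _ => by
    have := h (i + 1); push_cast at this; convert this using 1; ring
  have ha : a ≠ 0 := by simpa using h 0
  intro L
  rcases L with _ | L
  · simp [ha]
  -- Closed form of the partial sums; at `m = L` it is cancelled by the last term `r = L + 1`.
  have key : ∀ m ≤ L, ∑ r ∈ range (m + 1),
      (-1) ^ r * (a + 2 * r) * rise (1 + a) r / ((a + r) * r.factorial)
        / ((L + 1 - r).factorial * rise (1 + a) (L + 1 + r))
      = (-1) ^ m * rise (1 + a) m
        / ((L + 1) * m.factorial * (L - m).factorial * rise (1 + a) (L + 1 + m)) := by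
    intro m
    induction m with
    | zero =>
      intro _
      have := hr (L + 1)
      simp [ha, Nat.factorial_succ]
    | succ m ih =>
      intro hm
      obtain ⟨d, rfl⟩ := Nat.exists_eq_add_of_le hm
      rw [sum_range_succ, ih (by omega), show m + 1 + d - m = d + 1 by omega,
        show m + 1 + d + 1 - (m + 1) = d + 1 by omega, show m + 1 + d - (m + 1) = d by omega,
        show m + 1 + d + 1 + (m + 1) = m + 1 + d + 1 + m + 1 by omega,
        rise_succ _ (m + 1 + d + 1 + m), rise_succ _ m, Nat.factorial_succ m,
        Nat.factorial_succ d]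
      have h1 := hr (m + 1 + d + 1 + m)
      have h2 := h (m + 1)
      have h3 := h (m + 1 + d + 1 + m + 1)
      have h4 : (1 : ℝ) + a + (m + 1 + d + 1 + m : ℕ) ≠ 0 := by
        push_cast at h3 ⊢; convert h3 using 1; ring
      push_cast at h2 h4 ⊢
      field_simp
      ring
  have hL := key L le_rfl
  beta_reduce
  rw [sum_range_succ, hL, show L + 1 + (L + 1) = L + 1 + L + 1 by omega,
    rise_succ _ (L + 1 + L), rise_succ _ L, Nat.factorial_succ L]
  have h1 := hr (L + 1 + L)
  have h2 := h (L + 1)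
  have h3 := h (L + 1 + L + 1)
  have h4 : (1 : ℝ) + a + (L + 1 + L : ℕ) ≠ 0 := by
    push_cast at h3 ⊢; convert h3 using 1; ring
  push_cast at h2 h4 ⊢
  simp only [Nat.sub_self, Nat.factorial_zero, Nat.cast_one]
  field_simp
  ring

/-- The Bailey lemma. -/
theorem IsBaileyPair.step {a b c : ℝ} {α β : ℕ → ℝ} (h : IsBaileyPair a α β)
    (ha : ∀ k, rise (1 + a) k ≠ 0) (hb : ∀ k, rise (1 + a - b) k ≠ 0)
    (hc : ∀ k, rise (1 + a - c) k ≠ 0) :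
    IsBaileyPair a
      (fun r => rise b r * rise c r / (rise (1 + a - b) r * rise (1 + a - c) r) * α r)
      (fun L => ∑ j ∈ range (L + 1), rise b j * rise c j * rise (1 + a - b - c) (L - j)
        / ((L - j).factorial * (rise (1 + a - b) L * rise (1 + a - c) L)) * β j) := by
  intro L
  simp only [h _, mul_sum]
  rw [sum_comm' (t' := range (L + 1)) (s' := fun r => Ico r (L + 1))
    (by intro x y; simp only [mem_range, mem_Ico]; omega)]
  refine sum_congr rfl fun r hr => ?_
  obtain ⟨M, rfl⟩ := Nat.exists_eq_add_of_le (Nat.lt_succ_iff.1 (mem_range.1 hr))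
  rw [sum_Ico_eq_sum_range, show r + M + 1 - r = M + 1 by omega, show r + M - r = M by omega]
  -- After the interchange of sums the inner sum over `j = r + k` is Saalschützian, with all
  -- parameters shifted by `r`.
  have hs := sum_choose_mul_rise (1 + a + r + r) (b + r) (c + r) M
  rw [show 1 + a + r + r - (b + r) = 1 + a - b + r by ring,
    show 1 + a + r + r - (c + r) = 1 + a - c + r by ring,
    show 1 + a - b + r - (c + r) = 1 + a - b - c by ring] at hs
  have hterm : ∀ k ∈ range (M + 1),
      rise b (r + k) * rise c (r + k) * rise (1 + a - b - c) (r + M - (r + k))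
        / ((r + M - (r + k)).factorial * (rise (1 + a - b) (r + M) * rise (1 + a - c) (r + M)))
        * (α r / ((r + k - r).factorial * rise (1 + a) (r + k + r)))
      = α r * rise b r * rise c r / (M.factorial * rise (1 + a - b) (r + M) * rise (1 + a - c) (r + M)
          * rise (1 + a) (r + M + r))
        * ((M.choose k : ℝ) * rise (b + r) k * rise (c + r) k * rise (1 + a - b - c) (M - k)
          * rise (1 + a + r + r + k) (M - k)) := by
    intro k hk
    have hk' := Nat.lt_succ_iff.1 (mem_range.1 hk)
    obtain ⟨d, rfl⟩ := Nat.exists_eq_add_of_le hk'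
    rw [Nat.cast_choose ℝ hk', rise_add b, rise_add c, show r + (k + d) - (r + k) = d by omega,
      show k + d - k = d by omega, show r + k - r = k by omega,
      show r + (k + d) + r = (r + k + r) + d by omega, rise_add (1 + a) (r + k + r) d]
    have e : (1 : ℝ) + a + (r + k + r : ℕ) = 1 + a + r + r + k := by push_cast; ring
    have h1 := ha (r + k + r)
    have h2 := hb (r + (k + d))
    have h3 := hc (r + (k + d))
    have h4 : rise (1 + a + r + r + k) d ≠ 0 := by
      have := ha (r + k + r + d)
      rw [rise_add, e] at this
      exact right_ne_zero_of_mul this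
    rw [e]
    field_simp
  rw [sum_congr rfl hterm, ← mul_sum, hs, rise_add (1 + a - b), rise_add (1 + a - c)]
  have h1 := ha (r + M + r)
  have h2 := hb r
  have h3 := hc r
  have h4 : rise (1 + a - b + r) M ≠ 0 := by
    have := hb (r + M); rw [rise_add] at this; exact right_ne_zero_of_mul this
  have h5 : rise (1 + a - c + r) M ≠ 0 := by
    have := hc (r + M); rw [rise_add] at this; exact right_ne_zero_of_mul this
  field_simp

/-! ### Very-well-poised series as double sums. -/

/-- The factor contributed by the parameter `b` to the `r`-th term of a well-poised series. -/
noncomputable def poisedRatio (a b : ℝ) (r : ℕ) : ℝ := rise b r / rise (1 + a - b) r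

/-- The double sum into which a very-well-poised series with three pairs of parameters is
transformed by the Bailey lemma. -/
noncomputable def baileyDouble (a b₁ c₁ b₂ c₂ b₃ c₃ : ℝ) (n : ℕ) : ℝ :=
  (rise (1 + a - b₃) n * rise (1 + a - c₃) n)⁻¹ * ∑ j ∈ range (n + 1),
    rise b₃ j / rise (1 + a - b₂) j * (rise c₃ j / rise (1 + a - c₂) j)
      * (rise (1 + a - b₃ - c₃) (n - j) / (n - j).factorial)
      * ∑ i ∈ range (j + 1), rise b₂ i / rise (1 + a - b₁) i * (rise c₂ i / rise (1 + a - c₁) i)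
        * (rise (1 + a - b₂ - c₂) (j - i) / (j - i).factorial)
        * (rise (1 + a - b₁ - c₁) i / i.factorial)

/-- Three Bailey steps would give a triple sum; since `β` of the unit pair is supported at 0, the
innermost sum collapses. -/
theorem sum_poisedRatio_eq_baileyDouble {a b₁ c₁ b₂ c₂ b₃ c₃ : ℝ} (ha : ∀ k : ℕ, a + k ≠ 0)
    (hb₁ : ∀ k, rise (1 + a - b₁) k ≠ 0) (hc₁ : ∀ k, rise (1 + a - c₁) k ≠ 0)
    (hb₂ : ∀ k, rise (1 + a - b₂) k ≠ 0) (hc₂ : ∀ k, rise (1 + a - c₂) k ≠ 0)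
    (hb₃ : ∀ k, rise (1 + a - b₃) k ≠ 0) (hc₃ : ∀ k, rise (1 + a - c₃) k ≠ 0) (n : ℕ) :
    ∑ r ∈ range (n + 1), (-1) ^ r * (a + 2 * r) * rise (1 + a) r / ((a + r) * r.factorial)
        / ((n - r).factorial * rise (1 + a) (n + r))
        * (poisedRatio a b₁ r * poisedRatio a c₁ r * poisedRatio a b₂ r * poisedRatio a c₂ r
          * poisedRatio a b₃ r * poisedRatio a c₃ r)
      = baileyDouble a b₁ c₁ b₂ c₂ b₃ c₃ n := by
  have hr : ∀ k, rise (1 + a) k ≠ 0 := fun k => rise_ne_zero fun i _ => by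
    have := ha (i + 1); push_cast at this; convert this using 1; ring
  have h := (((isBaileyPair_unit ha).step hr hb₁ hc₁).step hr hb₂ hc₂).step hr hb₃ hc₃ n
  simp only [mul_ite, mul_one, mul_zero, sum_ite_eq', mem_range, Nat.succ_pos, if_true,
    rise_zero, Nat.sub_zero, one_mul] at h
  rw [baileyDouble, mul_sum]
  refine Eq.trans (sum_congr rfl fun r _ => ?_) (h.symm.trans (sum_congr rfl fun j _ => ?_))
  · simp only [poisedRatio]
    simp only [div_eq_mul_inv, mul_inv]
    ring
  · simp only [mul_sum]
    refine sum_congr rfl fun i _ => ?_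
    simp only [div_eq_mul_inv, mul_inv]
    ring

/-! ### Local expansions of the summand at the integers. -/

theorem rise_sub_mul_rise {n r : ℕ} (h : r ≤ n) (y : ℝ) :
    rise (y - n) r * rise (1 - y) (n - r) = (-1) ^ r * rise (1 - y) n := by
  obtain ⟨m, rfl⟩ := Nat.exists_eq_add_of_le' h
  rw [rise_reflect (y - _) r, Nat.add_sub_cancel, rise_add (1 - y) m r]
  push_cast
  rw [show 1 - (y - (m + r)) - (r : ℝ) = 1 - y + m by ring]
  ring

/-- Isolates the single factor `y` of a product crossing 0. With `y = 2e` it yields the simple pole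
of the series, with `y = e` the fourth-order poles of `poisedRational`. -/
theorem rise_sub_center (y : ℝ) (m r : ℕ) :
    rise (y - m) (m + r + 1) = (-1) ^ m * rise (1 - y) m * y * rise (1 + y) r := by
  have h := rise_sub_mul_rise le_rfl y (n := m)
  simp only [Nat.sub_self, rise_zero, mul_one] at h
  rw [add_assoc, rise_add, h, sub_add_cancel, rise_succ', add_comm y 1]
  ring

/-- The summand `(n/2 - l - e) C(n,l+e)^4 C(n+l+e,n)^2 C(2n-l-e,n)^2`, without the
transcendental factor that comes from the Gamma function. -/
noncomputable def wellPoised (n l : ℕ) (e : ℝ) : ℝ :=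
  ((n : ℝ) / 2 - l - e) * (rise (1 + e) (n + l) * rise (1 - e) (2 * n - l)) ^ 2
    / (rise (1 + e) l * rise (1 - e) (n - l)) ^ 6

theorem differentiableAt_wellPoised (n l : ℕ) : DifferentiableAt ℝ (wellPoised n l) 0 := by
  unfold wellPoised
  refine DifferentiableAt.div (by fun_prop) (by fun_prop) ?_
  have := (rise_pos one_pos l).ne'
  have := (rise_pos one_pos (n - l)).ne'
  simp_all

/-- Factor by factor, `(i + 2se) i` and `(i + se)²` differ only by `s²e²`. -/
theorem exists_hasDerivAt_rise (s : ℝ) (l : ℕ) :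
    ∃ D, HasDerivAt (fun e => rise (1 + s * (2 * e)) l * l.factorial) D 0
      ∧ HasDerivAt (fun e => rise (1 + s * e) l ^ 2) D 0 := by
  induction l with
  | zero => exact ⟨0, by simpa using hasDerivAt_const _ _, by simpa using hasDerivAt_const _ _⟩
  | succ l ih =>
    obtain ⟨D, h1, h2⟩ := ih
    have g1 : HasDerivAt (fun e : ℝ => (1 + s * (2 * e) + l) * (l + 1)) (2 * s * (l + 1)) 0 :=
      (((((hasDerivAt_id (0 : ℝ)).const_mul 2).const_mul s).const_add 1).add_const (l : ℝ)
        |>.mul_const ((l : ℝ) + 1)).congr_deriv (by ring)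
    have g2 : HasDerivAt (fun e : ℝ => (1 + s * e + l) ^ 2) (2 * s * (l + 1)) 0 :=
      (((((hasDerivAt_id (0 : ℝ)).const_mul s).const_add 1).add_const (l : ℝ)).pow 2).congr_deriv
        (by simp; ring)
    refine ⟨_, (h1.mul g1).congr_of_eventuallyEq (.of_forall fun e => ?_),
      ((h2.mul g2).congr_of_eventuallyEq (.of_forall fun e => ?_)).congr_deriv ?_⟩
    · simp only [rise_succ, Nat.factorial_succ, Pi.mul_apply]; push_cast; ring
    · simp only [rise_succ, Pi.mul_apply]; ring
    · simp [rise_one]; ring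

/-- A summand with the same value and derivative at `0` as `wellPoised`, which occurs as the
term of a well-poised series. -/
noncomputable def wellPoised' (n l : ℕ) (e : ℝ) : ℝ :=
  ((n : ℝ) / 2 - l - e) * (rise (1 + e) (n + l) * rise (1 - e) (2 * n - l)) ^ 2
    / ((rise (1 + e) l * rise (1 - e) (n - l)) ^ 4
      * (rise (1 + 2 * e) l * l.factorial * (rise (1 - 2 * e) (n - l) * (n - l).factorial)))

theorem hasDerivAt_wellPoised' (n l : ℕ) :
    HasDerivAt (wellPoised' n l) (deriv (wellPoised n l) 0) 0 := by
  obtain ⟨D₁, h1, h1'⟩ := exists_hasDerivAt_rise 1 l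
  obtain ⟨D₂, h2, h2'⟩ := exists_hasDerivAt_rise (-1) (n - l)
  simp only [one_mul, neg_one_mul, ← sub_eq_add_neg] at h1 h1' h2 h2'
  have hN : DifferentiableAt ℝ (fun e => ((n : ℝ) / 2 - l - e)
    * (rise (1 + e) (n + l) * rise (1 - e) (2 * n - l)) ^ 2) 0 := by fun_prop
  have hQ : DifferentiableAt ℝ (fun e => (rise (1 + e) l * rise (1 - e) (n - l)) ^ 4) 0 := by
    fun_prop
  have p1 := (rise_pos one_pos l).ne'
  have p2 := (rise_pos one_pos (n - l)).ne'
  have hf := hN.hasDerivAt.div (hQ.hasDerivAt.mul (h1'.mul h2')) (by simp [p1, p2])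
  have hg := hN.hasDerivAt.div (hQ.hasDerivAt.mul (h1.mul h2))
    (by simp [p1, p2, Nat.factorial_ne_zero])
  -- Of the sixth power only a square is exchanged, by the previous lemma with `s = 1` and `s = -1`.
  have e : wellPoised n l = fun e => ((n : ℝ) / 2 - l - e)
      * (rise (1 + e) (n + l) * rise (1 - e) (2 * n - l)) ^ 2
      / ((rise (1 + e) l * rise (1 - e) (n - l)) ^ 4
        * (rise (1 + e) l ^ 2 * rise (1 - e) (n - l) ^ 2)) := by
    ext e; rw [wellPoised]; congr 1; ring
  refine HasDerivAt.congr_deriv (f := wellPoised' n l) hg ?_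
  rw [e]
  refine Eq.trans ?_ hf.deriv.symm
  simp [rise_one, sq]

/-- The factorisation is required only off 0 because the series transformation degenerates at `e =
0`, where `a = -n`. -/
theorem HasDerivAt.eq_of_eventually_eq_mul {h E : ℝ → ℝ} {d : ℝ} (hd : HasDerivAt h d 0)
    (hE : ContinuousAt E 0) (heq : ∀ᶠ e in 𝓝[≠] 0, h e = e * E e) : d = E 0 := by
  have h0 : h 0 = 0 := by
    have t1 : Tendsto h (𝓝[≠] 0) (𝓝 (h 0)) := hd.continuousAt.tendsto.mono_left nhdsWithin_le_nhds
    have t2 : Tendsto (fun e => e * E e) (𝓝[≠] 0) (𝓝 (0 * E 0)) :=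
      (continuousAt_id.mul hE).tendsto.mono_left nhdsWithin_le_nhds
    rw [zero_mul] at t2
    exact tendsto_nhds_unique t1 (t2.congr' (heq.mono fun e he => he.symm))
  have t := hasDerivAt_iff_tendsto_slope.1 hd
  refine tendsto_nhds_unique t ((hE.tendsto.mono_left nhdsWithin_le_nhds).congr' ?_)
  filter_upwards [heq, self_mem_nhdsWithin] with e he hne
  have : e ≠ 0 := hne
  rw [slope_def_field, he, h0]
  field_simp
  ring

/-! ### Removing the Gamma factor. -/

theorem Gamma_one_add_add_natCast {e : ℝ} (he : |e| < 1) (m : ℕ) :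
    Real.Gamma (m + e + 1) = rise (1 + e) m * Real.Gamma (1 + e) := by
  have := (abs_lt.1 he).1
  induction m with
  | zero => simp [add_comm]
  | succ m ih =>
    have h : (m : ℝ) + e + 1 ≠ 0 := by
      have : (0 : ℝ) ≤ m := m.cast_nonneg
      linarith
    rw [Nat.cast_succ, show (m : ℝ) + 1 + e + 1 = m + e + 1 + 1 by ring, Real.Gamma_add_one h, ih,
      rise_succ]
    ring

/-- Each of `Γ(1+e)`, `Γ(1-e)` occurs twice in the numerator and six times in the denominator; the
powers of `n!` cancel. -/
theorem zetaFourTerm_natCast_add {n l : ℕ} (hl : l ≤ n) {e : ℝ} (he : |e| < 1) :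
    zetaFourTerm n (l + e)
      = ((Real.Gamma (1 + e) * Real.Gamma (1 - e))⁻¹) ^ 4 * wellPoised n l e := by
  have he' : |-e| < 1 := by rwa [abs_neg]
  obtain ⟨h1, h2⟩ := abs_lt.1 he
  have a1 := (Real.Gamma_pos_of_pos (show 0 < 1 + e by linarith)).ne'
  have a2 := (Real.Gamma_pos_of_pos (show 0 < 1 - e by linarith)).ne'
  have b1 := (rise_pos (show 0 < 1 + e by linarith) l).ne'
  have b2 := (rise_pos (show 0 < 1 - e by linarith) (n - l)).ne'
  have c0 : Real.Gamma ((n : ℝ) + 1) = n.factorial := Real.Gamma_nat_eq_factorial n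
  have c1 := Gamma_one_add_add_natCast he l
  have c2 := Gamma_one_add_add_natCast he' (n - l)
  have c3 := Gamma_one_add_add_natCast he (n + l)
  have c4 := Gamma_one_add_add_natCast he' (2 * n - l)
  rw [← sub_eq_add_neg, ← sub_eq_add_neg] at c2 c4
  rw [Nat.cast_sub hl] at c2
  rw [Nat.cast_sub (by omega)] at c4
  push_cast at c3 c4
  have hf : (n.factorial : ℝ) ≠ 0 := by exact_mod_cast n.factorial_ne_zero
  rw [zetaFourTerm, realBinom, realBinom, realBinom, c0, c1,
    show (n : ℝ) - (l + e) + 1 = n - l - e + 1 by ring, c2,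
    show (n : ℝ) + (l + e) + 1 = n + l + e + 1 by ring, c3,
    show (n : ℝ) + (l + e) - n + 1 = l + e + 1 by ring, c1,
    show 2 * (n : ℝ) - (l + e) + 1 = 2 * n - l - e + 1 by ring, c4,
    show 2 * (n : ℝ) - (l + e) - n + 1 = n - l - e + 1 by ring, c2, wellPoised]
  field_simp
  ring

/-- The function is even, so its derivative at 0 vanishes. -/
theorem hasDerivAt_Gamma_mul_Gamma_inv :
    HasDerivAt (fun e : ℝ => ((Real.Gamma (1 + e) * Real.Gamma (1 - e))⁻¹) ^ 4) 0 0 := by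
  set c : ℝ → ℝ := fun e => ((Real.Gamma (1 + e) * Real.Gamma (1 - e))⁻¹) ^ 4
  have hG : DifferentiableAt ℝ Real.Gamma 1 := Real.differentiableAt_Gamma fun m => by
    have : (0 : ℝ) ≤ m := m.cast_nonneg
    linarith
  have h1 : DifferentiableAt ℝ (fun e : ℝ => Real.Gamma (1 + e)) 0 :=
    DifferentiableAt.comp (g := Real.Gamma) (0 : ℝ) (by simpa using hG) (by fun_prop)
  have h2 : DifferentiableAt ℝ (fun e : ℝ => Real.Gamma (1 - e)) 0 :=
    DifferentiableAt.comp (g := Real.Gamma) (0 : ℝ) (by simpa using hG) (by fun_prop)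
  have hc : DifferentiableAt ℝ c 0 := ((h1.mul h2).inv (by simp)).pow 4
  have heven : (fun e => c (-e)) = c := by
    ext e; simp only [c, sub_neg_eq_add, ← sub_eq_add_neg, mul_comm]
  have h := deriv_comp_neg c 0
  rw [heven, neg_zero] at h
  have h0 : deriv c 0 = 0 := by linarith
  exact hc.hasDerivAt.congr_deriv h0

theorem hasDerivAt_zetaFourTerm {n l : ℕ} (hl : l ≤ n) :
    HasDerivAt (zetaFourTerm n) (deriv (wellPoised n l) 0) l := by
  have h : HasDerivAt (fun e => zetaFourTerm n (l + e)) (deriv (wellPoised n l) 0) 0 := by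
    have := hasDerivAt_Gamma_mul_Gamma_inv.mul (differentiableAt_wellPoised n l).hasDerivAt
    refine (this.congr_of_eventuallyEq ?_).congr_deriv (by simp)
    filter_upwards [Metric.ball_mem_nhds (0 : ℝ) one_pos] with e he
    exact zetaFourTerm_natCast_add hl (by simpa using he)
  rw [← sub_self (l : ℝ)] at h
  simpa using h.comp_sub_const (l : ℝ) (l : ℝ)

/-! ### The Bailey transformation in the limit `e → 0`. -/

theorem continuousAt_baileyDouble {n : ℕ} {b₁ c₁ b₂ c₂ b₃ c₃ : ℝ}
    (h : ∀ x ∈ ({b₁, c₁, b₂, c₂, b₃, c₃} : Set ℝ), ∀ k ≤ n, rise (1 - n - x) k ≠ 0) :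
    ContinuousAt (fun e : ℝ => baileyDouble (-n + 2 * e) (b₁ + e) (c₁ + e) (b₂ + e) (c₂ + e)
      (b₃ + e) (c₃ + e) n) 0 := by
  have h' : ∀ x ∈ ({b₁, c₁, b₂, c₂, b₃, c₃} : Set ℝ), ∀ k ≤ n,
      rise (1 + (-n + 2 * 0) - (x + 0)) k ≠ 0 := fun x hx k hk => by
    convert h x hx k hk using 2; ring
  have hdiv : ∀ x y : ℝ, y ∈ ({b₁, c₁, b₂, c₂, b₃, c₃} : Set ℝ) → ∀ k ≤ n,
      ContinuousAt (fun e : ℝ => rise (x + e) k / rise (1 + (-n + 2 * e) - (y + e)) k) 0 :=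
    fun x y hy k hk => ContinuousAt.div (by fun_prop) (by fun_prop) (h' y hy k hk)
  unfold baileyDouble
  refine ContinuousAt.mul (ContinuousAt.inv₀ (by fun_prop)
    (mul_ne_zero (h' _ (by simp) n le_rfl) (h' _ (by simp) n le_rfl))) ?_
  have hsum : ∀ (m : ℕ) (f : ℕ → ℝ → ℝ), (∀ j ≤ m, ContinuousAt (f j) 0) →
      ContinuousAt (fun e => ∑ j ∈ range (m + 1), f j e) 0 := fun m f hf =>
    tendsto_finsetSum _ fun j hj => hf j (Nat.lt_succ_iff.1 (mem_range.1 hj))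
  refine hsum n _ fun j hj => ?_
  have hb := hdiv b₃ b₂ (by simp) j hj
  have hc := hdiv c₃ c₂ (by simp) j hj
  refine ContinuousAt.mul (ContinuousAt.mul (ContinuousAt.mul hb hc)
    (ContinuousAt.div_const (ContinuousAt.rise (by fun_prop) _) _)) ?_
  refine hsum j _ fun i hi => ?_
  have hb := hdiv b₂ b₁ (by simp) i (hi.trans hj)
  have hc := hdiv c₂ c₁ (by simp) i (hi.trans hj)
  exact ContinuousAt.mul (ContinuousAt.mul (ContinuousAt.mul hb hc)
    (ContinuousAt.div_const (ContinuousAt.rise (by fun_prop) _) _))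
    (ContinuousAt.div_const (ContinuousAt.rise (by fun_prop) _) _)

theorem natCast_add_ne_zero_of_abs_lt {e : ℝ} (he : |e| < 1) (h0 : e ≠ 0) (k : ℤ) :
    (k : ℝ) + e ≠ 0 := by
  intro h
  have hk : |(k : ℝ)| < 1 := by rwa [show (k : ℝ) = -e by linarith, abs_neg]
  have : k = 0 := by
    rw [← Int.cast_abs] at hk
    exact Int.abs_lt_one_iff.1 (by exact_mod_cast hk)
  simp [this] at h
  exact h0 h

/-- Shifting `a` by `2e` and every parameter by `e` also shifts each `1 + a - b` by `e`: these
become `1 + e` and `-2n + e`. The condition `|2e| < 1` with `e ≠ 0` keeps `2e` away from the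
integers. -/
theorem wellPoised_term {n r : ℕ} (hr : r ≤ n) {e : ℝ} (he : |2 * e| < 1) (h0 : e ≠ 0) :
    (-1) ^ r * (-n + 2 * e + 2 * r) * rise (1 + (-n + 2 * e)) r
        / ((-n + 2 * e + r) * r.factorial)
        / ((n - r).factorial * rise (1 + (-n + 2 * e)) (n + r))
        * (poisedRatio (-n + 2 * e) (-n + e) r ^ 4 * poisedRatio (-n + 2 * e) (n + 1 + e) r ^ 2)
      = -(-1) ^ n * rise (1 - e) n ^ 4 / (rise (1 + e) n * rise (1 - e) (2 * n)) ^ 2 / e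
        * wellPoised' n r e := by
  have h20 : 2 * e ≠ 0 := by simpa using h0
  have he1 : |e| < 1 := by rw [abs_mul, abs_two] at he; linarith [abs_nonneg e]
  obtain ⟨l1, l2⟩ := abs_lt.1 he
  have p1 : ∀ k, rise (1 + e) k ≠ 0 := fun k => (rise_pos (by linarith) k).ne'
  have p2 : ∀ k, rise (1 - e) k ≠ 0 := fun k => (rise_pos (by linarith) k).ne'
  have p3 : ∀ k, rise (1 + 2 * e) k ≠ 0 := fun k => (rise_pos (by linarith) k).ne'
  have p4 : ∀ k, rise (1 - 2 * e) k ≠ 0 := fun k => (rise_pos (by linarith) k).ne'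
  have q1 : rise (1 + (-n + 2 * e)) r ≠ 0 := rise_ne_zero fun i _ => by
    have := natCast_add_ne_zero_of_abs_lt he h20 (1 - n + i)
    push_cast at this; convert this using 1; ring
  have q2 : (-n + 2 * e + r : ℝ) ≠ 0 := by
    have := natCast_add_ne_zero_of_abs_lt he h20 (r - n)
    push_cast at this; convert this using 1; ring
  -- The product from `a + r` to `a + r + n` crosses 0 and contributes the factor `2e`.
  have hcen : (-n + 2 * e + r) * rise (1 + (-n + 2 * e)) (n + r)
      = rise (1 + (-n + 2 * e)) r
        * ((-1) ^ (n - r) * rise (1 - 2 * e) (n - r) * (2 * e) * rise (1 + 2 * e) r) := by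
    rw [← rise_sub_center, Nat.cast_sub hr, Nat.sub_add_cancel hr, rise_succ', add_comm n r,
      rise_add, show 1 + (-(n : ℝ) + 2 * e) + r = 2 * e - (n - r) + 1 by ring]
    ring
  have hX : rise (-n + e) r = (-1) ^ r * rise (1 - e) n / rise (1 - e) (n - r) := by
    rw [eq_div_iff (p2 _), ← rise_sub_mul_rise hr, neg_add_eq_sub]
  have hX' : 1 + (-(n : ℝ) + 2 * e) - (-n + e) = 1 + e := by ring
  have hY : rise (n + 1 + e) r = rise (1 + e) (n + r) / rise (1 + e) n := by
    rw [eq_div_iff (p1 _), rise_add, show (n : ℝ) + 1 + e = 1 + e + n by ring, mul_comm]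
  have hY' : rise (1 + (-(n : ℝ) + 2 * e) - (n + 1 + e)) r
      = (-1) ^ r * rise (1 - e) (2 * n) / rise (1 - e) (2 * n - r) := by
    rw [eq_div_iff (p2 _), ← rise_sub_mul_rise (by omega)]
    congr 2
    push_cast; ring
  have hs : ((-1 : ℝ) ^ r) ^ 2 = 1 := by rw [← pow_mul, mul_comm, pow_mul]; simp
  have hsn : (-1 : ℝ) ^ n = (-1) ^ (n - r) * (-1) ^ r := by rw [← pow_add, Nat.sub_add_cancel hr]
  have hs' : ((-1 : ℝ) ^ (n - r)) ^ 2 = 1 := by rw [← pow_mul, mul_comm, pow_mul]; simp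
  have hfirst : (-1) ^ r * (-n + 2 * e + 2 * r) * rise (1 + (-n + 2 * e)) r
        / ((-n + 2 * e + r) * r.factorial)
        / ((n - r).factorial * rise (1 + (-n + 2 * e)) (n + r))
      = (-1) ^ n * (-n + 2 * e + 2 * r) / (2 * e * r.factorial * (n - r).factorial
        * (rise (1 - 2 * e) (n - r) * rise (1 + 2 * e) r)) := by
    rw [div_div, show (-(n : ℝ) + 2 * e + r) * r.factorial
      * ((n - r).factorial * rise (1 + (-n + 2 * e)) (n + r))
      = r.factorial * (n - r).factorial
        * ((-n + 2 * e + r) * rise (1 + (-n + 2 * e)) (n + r)) by ring, hcen, hsn]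
    have := p3 r
    have := p4 (n - r)
    have : (-1 : ℝ) ^ (n - r) ≠ 0 := by simp
    field_simp
    linear_combination (-(n : ℝ) + 2 * e + 2 * r) * (-hs')
  have hsr : (-1 : ℝ) ^ r ≠ 0 := by simp
  rw [hfirst, poisedRatio, poisedRatio, hX, hX', hY, hY', wellPoised']
  generalize (-1 : ℝ) ^ r = s at *
  have h4 : s ^ 4 = 1 := by rw [show s ^ 4 = (s ^ 2) ^ 2 by ring, hs]; simp
  have := p1 r; have := p1 n; have := p1 (n + r)
  have := p2 (n - r); have := p2 (2 * n); have := p2 (2 * n - r)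
  have := p3 r; have := p4 (n - r)
  simp only [div_pow, mul_pow, h4, hs]
  field_simp
  ring

/-- The sum of the derivatives is any of the double sums attached to a distribution of the
parameters `-n` (four times) and `n + 1` (twice) into three pairs. -/
theorem neg_sum_deriv_wellPoised (n : ℕ) {b₁ c₁ b₂ c₂ b₃ c₃ : ℝ}
    (h : ∀ x ∈ ({b₁, c₁, b₂, c₂, b₃, c₃} : Set ℝ), x = -n ∨ x = n + 1)
    (hprod : ∀ g : ℝ → ℝ, g b₁ * g c₁ * g b₂ * g c₂ * g b₃ * g c₃ = g (-n) ^ 4 * g (n + 1) ^ 2) :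
    -∑ l ∈ range (n + 1), deriv (wellPoised n l) 0
      = (-1) ^ n * ((2 * n).factorial / n.factorial) ^ 2
        * baileyDouble (-n) b₁ c₁ b₂ c₂ b₃ c₃ n := by
  -- At `e = 0` the denominators are `(1)_k` and `(-2n)_k`; the latter is nonzero because `k ≤ n`.
  have hne : ∀ x ∈ ({b₁, c₁, b₂, c₂, b₃, c₃} : Set ℝ), ∀ k ≤ n, rise (1 - n - x) k ≠ 0 := by
    intro x hx k hk
    rcases h x hx with rfl | rfl
    · rw [show (1 : ℝ) - n - -n = 1 by ring]
      exact (rise_pos one_pos k).ne'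
    · refine rise_ne_zero fun i hi => ?_
      have : (i : ℝ) + 1 ≤ n := by exact_mod_cast (Nat.lt_of_lt_of_le hi hk)
      have : (0 : ℝ) ≤ i := i.cast_nonneg
      intro h0
      linarith
  set E : ℝ → ℝ := fun e => -(-1) ^ n * ((rise (1 + e) n * rise (1 - e) (2 * n)) ^ 2
    / rise (1 - e) n ^ 4) * baileyDouble (-n + 2 * e) (b₁ + e) (c₁ + e) (b₂ + e) (c₂ + e)
      (b₃ + e) (c₃ + e) n with hE
  have hEc : ContinuousAt E 0 := by
    refine ContinuousAt.mul (ContinuousAt.mul (by fun_prop) (ContinuousAt.div (by fun_prop)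
      (by fun_prop) ?_)) (continuousAt_baileyDouble hne)
    have := (rise_pos one_pos n).ne'
    simpa
  have hd : HasDerivAt (fun e => ∑ l ∈ range (n + 1), wellPoised' n l e)
      (∑ l ∈ range (n + 1), deriv (wellPoised n l) 0) 0 :=
    HasDerivAt.fun_sum fun l _ => hasDerivAt_wellPoised' n l
  have key := hd.eq_of_eventually_eq_mul hEc ?_
  · rw [key, hE]
    simp only [mul_zero, add_zero, sub_zero, rise_one]
    have : (n.factorial : ℝ) ≠ 0 := by exact_mod_cast n.factorial_ne_zero
    field_simp
  · have hball : ∀ᶠ e in 𝓝[≠] (0 : ℝ), |2 * e| < 1 := by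
      refine nhdsWithin_le_nhds ?_
      have : ContinuousAt (fun e : ℝ => |2 * e|) 0 := by fun_prop
      exact this.eventually_lt continuousAt_const (by simp)
    filter_upwards [hball, self_mem_nhdsWithin] with e he h0
    have h0 : e ≠ 0 := h0
    have h20 : 2 * e ≠ 0 := by simpa using h0
    have he1 : |e| < 1 := by rw [abs_mul, abs_two] at he; linarith [abs_nonneg e]
    have hx : ∀ x ∈ ({b₁, c₁, b₂, c₂, b₃, c₃} : Set ℝ), ∀ k,
        rise (1 + (-n + 2 * e) - (x + e)) k ≠ 0 := by
      intro x hx k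
      refine rise_ne_zero fun i _ => ?_
      rcases h x hx with rfl | rfl
      · have := natCast_add_ne_zero_of_abs_lt he1 h0 (1 + i)
        push_cast at this; convert this using 1; ring
      · have := natCast_add_ne_zero_of_abs_lt he1 h0 (i - 2 * n)
        push_cast at this; convert this using 1; ring
    have hsum := sum_poisedRatio_eq_baileyDouble (a := -n + 2 * e) (fun k => by
      have := natCast_add_ne_zero_of_abs_lt he h20 (k - n)
      push_cast at this; convert this using 1; ring)
      (hx b₁ (by simp)) (hx c₁ (by simp)) (hx b₂ (by simp)) (hx c₂ (by simp))
      (hx b₃ (by simp)) (hx c₃ (by simp)) n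
    rw [hE]
    beta_reduce
    rw [← hsum, mul_sum, mul_sum]
    refine sum_congr rfl fun r hr => ?_
    -- `hprod` encodes the equality of multisets of parameters through test functions; here the test
    -- function is the poised ratio.
    rw [hprod fun x => poisedRatio (-n + 2 * e) (x + e) r,
      wellPoised_term (Nat.lt_succ_iff.1 (mem_range.1 hr)) he h0]
    obtain ⟨l1, l2⟩ := abs_lt.1 he1
    have p1 := (rise_pos (show 0 < 1 + e by linarith) n).ne'
    have p2 := (rise_pos (show 0 < 1 - e by linarith) n).ne'
    have p3 := (rise_pos (show 0 < 1 - e by linarith) (2 * n)).ne'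
    have hs : ((-1 : ℝ) ^ n) ^ 2 = 1 := by rw [← pow_mul, mul_comm, pow_mul]; simp
    field_simp
    rw [hs]
    ring

/-! ### The three-term recursion by creative telescoping. -/

/-- The polynomial part of the certificate for the recursion of `wellPoised`. -/
noncomputable def certPoly (n x : ℝ) : ℝ :=
  ((399 * n ^ 3 + 4195 * n ^ 4 + 18623 * n ^ 5 + 45071 * n ^ 6 + 63989 * n ^ 7 + 53225 * n ^ 8 +
      24029 * n ^ 9 + 4549 * n ^ 10)
   + (-84 * n ^ 2 - 2546 * n ^ 3 - 19084 * n ^ 4 - 66398 * n ^ 5 - 125388 * n ^ 6 - 132190 * n ^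
      7 - 73076 * n ^ 8 - 16498 * n ^ 9) * x
   + (-213 * n - 1866 * n ^ 2 - 3720 * n ^ 3 + 10626 * n ^ 4 + 58503 * n ^ 5 + 101074 * n ^ 6 +
      78038 * n ^ 7 + 22774 * n ^ 8) * x ^ 2
   + (78 + 1678 * n + 10772 * n ^ 2 + 30372 * n ^ 3 + 37966 * n ^ 4 + 9730 * n ^ 5 - 18848 * n ^
      6 - 11812 * n ^ 7) * x ^ 3
   + (-317 - 4267 * n - 20903 * n ^ 2 - 49083 * n ^ 3 - 57401 * n ^ 4 - 29548 * n ^ 5 - 3965 * n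
      ^ 6) * x ^ 4
   + (516 + 5118 * n + 19236 * n ^ 2 + 34346 * n ^ 3 + 28690 * n ^ 4 + 8666 * n ^ 5) * x ^ 5
   + (-422 - 3181 * n - 8899 * n ^ 2 - 10876 * n ^ 3 - 4796 * n ^ 4) * x ^ 6
   + (174 + 980 * n + 1882 * n ^ 2 + 1220 * n ^ 3) * x ^ 7
   + (-29 - 115 * n - 122 * n ^ 2) * x ^ 8) / 2

/-- The telescoping relation with denominators and common factors cleared. The middle sign is
opposite to that in the recursion for `u` because the sums carry `(-1)^n`. -/
theorem certPoly_telescope (n x : ℝ) :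
    (n + 1) ^ 5 * (((n + 1) / 2 - x) * (x + n) ^ 2 * (x + n + 1) ^ 2 * (2 * n - 1 - x) ^ 2
        * (2 * n - x) ^ 2 * (2 * n + 1 - x) ^ 2 * (2 * n + 2 - x) ^ 2)
      + 3 * (2 * n + 1) * (3 * n ^ 2 + 3 * n + 1) * (15 * n ^ 2 + 15 * n + 4)
        * ((n / 2 - x) * (x + n) ^ 2 * (n + 1 - x) ^ 2 * (2 * n - 1 - x) ^ 2 * (2 * n - x) ^ 2
          * (x - n - 1) ^ 4)
      - 3 * n ^ 3 * (3 * n - 1) * (3 * n + 1)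
        * (((n - 1) / 2 - x) * (n - x) ^ 2 * (n + 1 - x) ^ 2 * (x - n) ^ 4 * (x - n - 1) ^ 4)
      = certPoly n (x + 1) * (x + n) ^ 2 * (n + 1 - x) ^ 2 * (x - n - 1) ^ 4
        - certPoly n x * x ^ 6 * (2 * n - 1 - x) ^ 2 := by
  unfold certPoly
  ring

/-- The rational function whose Laurent expansions at the integers give `wellPoised`. -/
noncomputable def poisedRational (n : ℕ) (x : ℝ) : ℝ :=
  ((n : ℝ) / 2 - x) * (rise (x + 1) n * rise (n + 1 - x) n) ^ 2 / rise (x - n) (n + 1) ^ 4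

/-- The rational certificate for the recursion of `poisedRational`, at index `k + 2`. -/
noncomputable def poisedCert (k : ℕ) (x : ℝ) : ℝ :=
  certPoly (k + 2) x * (rise x (k + 2) * rise (k + 4 - x) k) ^ 2 / rise (x - k - 3) (k + 3) ^ 4

/-- The denominator of `poisedRational` has a zero of order 4 at each of `0, …, n`. -/
theorem wellPoised_eq {n l : ℕ} (hl : l ≤ n) {e : ℝ} (he : |e| < 1) (h0 : e ≠ 0) :
    wellPoised n l e = e ^ 4 * poisedRational n (l + e) := by
  obtain ⟨l1, l2⟩ := abs_lt.1 he
  obtain ⟨m, rfl⟩ := Nat.exists_eq_add_of_le hl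
  have p1 := (rise_pos (show 0 < 1 + e by linarith) l).ne'
  have p2 := (rise_pos (show 0 < 1 - e by linarith) m).ne'
  have hc := rise_sub_center e m l
  rw [wellPoised, poisedRational, show l + m + l = l + (l + m) by omega,
    show 2 * (l + m) - l = m + (l + m) by omega, Nat.add_sub_cancel_left, rise_add (1 + e) l,
    rise_add (1 - e) m, show (l : ℝ) + e + 1 = 1 + e + l by ring,
    show ((l + m : ℕ) : ℝ) + 1 - (l + e) = 1 - e + m by push_cast; ring,
    show (l : ℝ) + e - (l + m : ℕ) = e - m by push_cast; ring,
    show l + m + 1 = m + l + 1 by omega, hc]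
  have hs : (((-1 : ℝ) ^ m) ^ 4) = 1 := by rw [← pow_mul, mul_comm, pow_mul]; norm_num
  simp only [mul_pow, hs]
  field_simp
  ring

theorem poisedRational_rec (k : ℕ) {x : ℝ} (hx : ∀ m : ℤ, x + m ≠ 0) :
    ((k : ℝ) + 2 + 1) ^ 5 * poisedRational (k + 3) x
      + 3 * (2 * ((k : ℝ) + 2) + 1) * (3 * ((k : ℝ) + 2) ^ 2 + 3 * ((k : ℝ) + 2) + 1)
        * (15 * ((k : ℝ) + 2) ^ 2 + 15 * ((k : ℝ) + 2) + 4) * poisedRational (k + 2) x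
      - 3 * ((k : ℝ) + 2) ^ 3 * (3 * ((k : ℝ) + 2) - 1) * (3 * ((k : ℝ) + 2) + 1)
        * poisedRational (k + 1) x
      = poisedCert k (x + 1) - poisedCert k x := by
  have h1 : x ≠ 0 := by simpa using hx 0
  have h2 : x - (k + 2) ≠ 0 := by
    have := hx (-(k + 2)); push_cast at this; convert this using 1; ring
  have h3 : x - (k + 2) - 1 ≠ 0 := by
    have := hx (-(k + 3)); push_cast at this; convert this using 1; ring
  have h4 : 2 * ((k : ℝ) + 2) - 1 - x ≠ 0 := by
    have := hx (-(2 * k + 3)); push_cast at this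
    intro h; apply this; linarith
  have hc0 : rise (x - (k + 2)) (k + 3) ≠ 0 := rise_ne_zero fun i _ => by
    have := hx (i - (k + 2)); push_cast at this; convert this using 1; ring
  set a := rise (x + 1) (k + 1) with ha
  set b := rise ((k : ℝ) + 4 - x) k with hb
  set c := rise (x - (k + 2)) (k + 3) with hc
  have a1 : rise (x + 1) (k + 2) = a * (x + (k + 2)) := by
    rw [rise_succ]; push_cast; ring
  have a2 : rise (x + 1) (k + 3) = a * (x + (k + 2)) * (x + (k + 2) + 1) := by
    rw [rise_succ, a1]; push_cast; ring
  have a3 : rise x (k + 2) = x * a := by rw [rise_succ']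
  have b1 : rise ((k : ℝ) + 2 - x) (k + 1)
      = ((k : ℝ) + 2 - x) * ((k : ℝ) + 2 + 1 - x) * b / (2 * ((k : ℝ) + 2) - 1 - x) := by
    rw [eq_div_iff h4]
    have e1 := rise_succ ((k : ℝ) + 2 - x) (k + 1)
    rw [rise_succ', rise_succ', show (k : ℝ) + 2 - x + 1 + 1 = k + 4 - x by ring, ← hb] at e1
    push_cast at e1
    linear_combination -e1
  have b2 : rise ((k : ℝ) + 3 - x) (k + 2)
      = ((k : ℝ) + 2 + 1 - x) * b * (2 * ((k : ℝ) + 2) - x) := by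
    rw [rise_succ', rise_succ, show (k : ℝ) + 3 - x + 1 = k + 4 - x by ring, ← hb]
    ring
  have b3 : rise ((k : ℝ) + 4 - x) (k + 3)
      = b * (2 * ((k : ℝ) + 2) - x) * (2 * ((k : ℝ) + 2) + 1 - x)
        * (2 * ((k : ℝ) + 2) + 2 - x) := by
    rw [rise_succ, rise_succ, rise_succ, ← hb]; push_cast; ring
  have b4 : rise ((k : ℝ) + 3 - x) k
      = ((k : ℝ) + 2 + 1 - x) * b / (2 * ((k : ℝ) + 2) - 1 - x) := by
    rw [eq_div_iff h4]
    have e1 := rise_succ ((k : ℝ) + 3 - x) k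
    rw [rise_succ', show (k : ℝ) + 3 - x + 1 = k + 4 - x by ring, ← hb] at e1
    linear_combination -e1
  have c1 : rise (x - (k + 3)) (k + 4) = (x - (k + 2) - 1) * c := by
    rw [rise_succ', show x - ((k : ℝ) + 3) + 1 = x - (k + 2) by ring, ← hc]; ring
  have c2 : rise (x - (k + 1)) (k + 2) = c / (x - (k + 2)) := by
    rw [eq_div_iff h2, hc, rise_succ' (x - ((k : ℝ) + 2)), show x - ((k : ℝ) + 2) + 1 = x - (k + 1) by ring]
    ring
  have c3 : rise (x - (k + 3)) (k + 3) = (x - (k + 2) - 1) * c / x := by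
    rw [eq_div_iff h1, ← c1, rise_succ _ (k + 3)]; push_cast; ring
  -- All five terms are written over one common factor, leaving the polynomials of
  -- `certPoly_telescope` at `n = k + 2`.
  have r1 : poisedRational (k + 3) x = a ^ 2 * b ^ 2
        / (c ^ 4 * (x - (k + 2) - 1) ^ 4 * (2 * ((k : ℝ) + 2) - 1 - x) ^ 2)
      * (((((k : ℝ) + 2) + 1) / 2 - x) * (x + (k + 2)) ^ 2 * (x + (k + 2) + 1) ^ 2
        * (2 * ((k : ℝ) + 2) - 1 - x) ^ 2
        * (2 * ((k : ℝ) + 2) - x) ^ 2 * (2 * ((k : ℝ) + 2) + 1 - x) ^ 2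
        * (2 * ((k : ℝ) + 2) + 2 - x) ^ 2) := by
    rw [poisedRational]
    push_cast
    rw [show (k : ℝ) + 3 + 1 - x = k + 4 - x by ring, a2, b3, c1]
    field_simp
    ring
  have r2 : poisedRational (k + 2) x = a ^ 2 * b ^ 2
        / (c ^ 4 * (x - (k + 2) - 1) ^ 4 * (2 * ((k : ℝ) + 2) - 1 - x) ^ 2)
      * ((((k : ℝ) + 2) / 2 - x) * (x + (k + 2)) ^ 2 * (((k : ℝ) + 2) + 1 - x) ^ 2
        * (2 * ((k : ℝ) + 2) - 1 - x) ^ 2 * (2 * ((k : ℝ) + 2) - x) ^ 2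
          * (x - (k + 2) - 1) ^ 4) := by
    rw [poisedRational]
    push_cast
    rw [show (k : ℝ) + 2 + 1 - x = k + 3 - x by ring, a1, b2, ← hc]
    field_simp
    ring
  have r3 : poisedRational (k + 1) x = a ^ 2 * b ^ 2
        / (c ^ 4 * (x - (k + 2) - 1) ^ 4 * (2 * ((k : ℝ) + 2) - 1 - x) ^ 2)
      * (((((k : ℝ) + 2) - 1) / 2 - x) * (((k : ℝ) + 2) - x) ^ 2 * (((k : ℝ) + 2) + 1 - x) ^ 2
        * (x - (k + 2)) ^ 4 * (x - (k + 2) - 1) ^ 4) := by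
    rw [poisedRational]
    push_cast
    rw [show (k : ℝ) + 1 + 1 - x = k + 2 - x by ring, ← ha, b1, c2]
    field_simp
    ring
  have r4 : poisedCert k (x + 1) = a ^ 2 * b ^ 2
        / (c ^ 4 * (x - (k + 2) - 1) ^ 4 * (2 * ((k : ℝ) + 2) - 1 - x) ^ 2)
      * (certPoly (k + 2) (x + 1) * (x + (k + 2)) ^ 2 * (((k : ℝ) + 2) + 1 - x) ^ 2
        * (x - (k + 2) - 1) ^ 4) := by
    rw [poisedCert, show (k : ℝ) + 4 - (x + 1) = k + 3 - x by ring, a1, b4,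
      show x + 1 - (k : ℝ) - 3 = x - (k + 2) by ring, ← hc]
    field_simp
  have r5 : poisedCert k x = a ^ 2 * b ^ 2
        / (c ^ 4 * (x - (k + 2) - 1) ^ 4 * (2 * ((k : ℝ) + 2) - 1 - x) ^ 2)
      * (certPoly (k + 2) x * x ^ 6 * (2 * ((k : ℝ) + 2) - 1 - x) ^ 2) := by
    rw [poisedCert, a3, ← hb, show x - (k : ℝ) - 3 = x - (k + 3) by ring, c3]
    field_simp
  rw [r1, r2, r3, r4, r5]
  have := certPoly_telescope ((k : ℝ) + 2) x
  linear_combination (a ^ 2 * b ^ 2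
    / (c ^ 4 * (x - (k + 2) - 1) ^ 4 * (2 * ((k : ℝ) + 2) - 1 - x) ^ 2)) * this

theorem continuousAt_poisedRational {n l : ℕ} (hl : n < l) :
    ContinuousAt (fun e : ℝ => poisedRational n (l + e)) 0 := by
  unfold poisedRational
  refine ContinuousAt.div (by fun_prop) (by fun_prop) (pow_ne_zero _ (rise_pos ?_ _).ne')
  have : (n : ℝ) < l := by exact_mod_cast hl
  linarith

theorem continuousAt_poisedCert {k : ℕ} {y : ℝ} (hy : rise (y - k - 3) (k + 3) ≠ 0) :
    ContinuousAt (fun e : ℝ => poisedCert k (y + e)) 0 := by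
  unfold poisedCert certPoly
  refine ContinuousAt.div (by fun_prop) (by fun_prop) (pow_ne_zero _ ?_)
  simpa using hy

/-- The sum of the derivatives satisfies the three-term recursion. -/
theorem sum_deriv_wellPoised_rec (k : ℕ) :
    ((k : ℝ) + 2 + 1) ^ 5 * ∑ l ∈ range (k + 3 + 1), deriv (wellPoised (k + 3) l) 0
      + 3 * (2 * ((k : ℝ) + 2) + 1) * (3 * ((k : ℝ) + 2) ^ 2 + 3 * ((k : ℝ) + 2) + 1)
        * (15 * ((k : ℝ) + 2) ^ 2 + 15 * ((k : ℝ) + 2) + 4)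
        * ∑ l ∈ range (k + 2 + 1), deriv (wellPoised (k + 2) l) 0
      - 3 * ((k : ℝ) + 2) ^ 3 * (3 * ((k : ℝ) + 2) - 1) * (3 * ((k : ℝ) + 2) + 1)
        * ∑ l ∈ range (k + 1 + 1), deriv (wellPoised (k + 1) l) 0 = 0 := by
  have hd : ∀ n : ℕ, HasDerivAt (fun e => ∑ l ∈ range (n + 1), wellPoised n l e)
      (∑ l ∈ range (n + 1), deriv (wellPoised n l) 0) 0 := fun n =>
    HasDerivAt.fun_sum fun l _ => (differentiableAt_wellPoised n l).hasDerivAt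
  set p := ((k : ℝ) + 2 + 1) ^ 5
  set q := 3 * (2 * ((k : ℝ) + 2) + 1) * (3 * ((k : ℝ) + 2) ^ 2 + 3 * ((k : ℝ) + 2) + 1)
        * (15 * ((k : ℝ) + 2) ^ 2 + 15 * ((k : ℝ) + 2) + 4)
  set r := 3 * ((k : ℝ) + 2) ^ 3 * (3 * ((k : ℝ) + 2) - 1) * (3 * ((k : ℝ) + 2) + 1)
  have h := (((hd (k + 3)).const_mul p).add ((hd (k + 2)).const_mul q)).sub
    ((hd (k + 1)).const_mul r)
  -- Boundary values of the certificate, corrected by the terms with `l > n` that appear when all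
  -- three sums are extended to `l = k + 3`. The poles of `poisedCert k` lie among `1, …, k + 3`, so
  -- both ends are regular.
  set K : ℝ → ℝ := fun e => poisedCert k ((k + 4 : ℕ) + e) - poisedCert k (0 + e)
    - q * poisedRational (k + 2) ((k + 3 : ℕ) + e)
    + r * (poisedRational (k + 1) ((k + 2 : ℕ) + e) + poisedRational (k + 1) ((k + 3 : ℕ) + e))
    with hK
  have hKc : ContinuousAt K 0 := by
    have k1 := continuousAt_poisedCert (k := k) (y := (k + 4 : ℕ)) (rise_pos (by
      push_cast; linarith) _).ne'
    have k2 := continuousAt_poisedCert (k := k) (y := 0) (rise_ne_zero fun i hi => by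
      have : (i : ℝ) + 1 ≤ k + 3 := by exact_mod_cast hi
      intro h0; linarith)
    have k3 := continuousAt_poisedRational (show k + 2 < k + 3 by omega)
    have k4 := continuousAt_poisedRational (show k + 1 < k + 2 by omega)
    have k5 := continuousAt_poisedRational (show k + 1 < k + 3 by omega)
    exact ((k1.sub k2).sub (k3.const_mul q)).add ((k4.add k5).const_mul r)
  have hE : ContinuousAt (fun e => e ^ 3 * K e) 0 := (by fun_prop : ContinuousAt _ _).mul hKc
  refine (h.eq_of_eventually_eq_mul hE ?_).trans (by simp)
  filter_upwards [nhdsWithin_le_nhds (Metric.ball_mem_nhds (0 : ℝ) one_pos),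
    self_mem_nhdsWithin] with e he h0
  have he : |e| < 1 := by simpa using he
  have h0 : e ≠ 0 := h0
  have hw : ∀ n : ℕ, ∑ l ∈ range (n + 1), wellPoised n l e
      = e ^ 4 * ∑ l ∈ range (n + 1), poisedRational n (l + e) := fun n => by
    rw [mul_sum]
    exact sum_congr rfl fun l hl => wellPoised_eq (Nat.lt_succ_iff.1 (mem_range.1 hl)) he h0
  have htel : p * ∑ l ∈ range (k + 4), poisedRational (k + 3) (l + e)
      + q * ∑ l ∈ range (k + 4), poisedRational (k + 2) (l + e)
      - r * ∑ l ∈ range (k + 4), poisedRational (k + 1) (l + e)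
      = poisedCert k ((k + 4 : ℕ) + e) - poisedCert k (0 + e) := by
    have := sum_range_sub (fun l : ℕ => poisedCert k (l + e)) (k + 4)
    simp only [Nat.cast_zero] at this
    rw [← this, mul_sum, mul_sum, mul_sum, ← sum_add_distrib, ← sum_sub_distrib]
    refine sum_congr rfl fun l _ => ?_
    rw [poisedRational_rec k fun m => ?_]
    · push_cast; ring_nf
    · have := natCast_add_ne_zero_of_abs_lt he h0 (l + m)
      push_cast at this; convert this using 1; ring
  simp only [Pi.add_apply, Pi.sub_apply, hw, hK]
  rw [← htel, sum_range_succ _ (k + 3), sum_range_succ _ (k + 3), sum_range_succ _ (k + 3),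
    sum_range_succ _ (k + 2), sum_range_succ _ (k + 2), sum_range_succ _ (k + 2)]
  ring

/-! ### Specialisation to binomial double sums. -/

theorem rise_div_factorial (n k : ℕ) :
    rise (n + 1) k / k.factorial = ((n + k).choose n : ℝ) := by
  have h := rise_add 1 n k
  rw [rise_one, rise_one, add_comm (1 : ℝ)] at h
  have h1 : (n.factorial : ℝ) ≠ 0 := by exact_mod_cast n.factorial_ne_zero
  have h2 : (k.factorial : ℝ) ≠ 0 := by exact_mod_cast k.factorial_ne_zero
  rw [Nat.cast_add_choose, h]
  field_simp

theorem rise_neg_natCast {n k : ℕ} (h : k ≤ n) :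
    rise (-n) k = (-1) ^ k * (n.factorial / (n - k).factorial) := by
  have := rise_sub_mul_rise h 0
  simp only [zero_sub, sub_zero, rise_one] at this
  have h2 : ((n - k).factorial : ℝ) ≠ 0 := by exact_mod_cast (n - k).factorial_ne_zero
  rw [← mul_div_assoc, eq_div_iff h2, this]

theorem rise_neg_div_factorial {n k : ℕ} (h : k ≤ n) :
    rise (-n) k / k.factorial = (-1) ^ k * (n.choose k : ℝ) := by
  rw [rise_neg_natCast h, Nat.cast_choose ℝ h]
  have h1 : (k.factorial : ℝ) ≠ 0 := by exact_mod_cast k.factorial_ne_zero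
  have h2 : ((n - k).factorial : ℝ) ≠ 0 := by exact_mod_cast (n - k).factorial_ne_zero
  field_simp

/-- Together with the prefactor of `baileyDouble`, these constants cancel `((2n)!/n!)²`. -/
theorem rise_neg_div_rise_neg {n k : ℕ} (h : k ≤ n) :
    rise (-n) k / rise (-(2 * n : ℕ)) k
      = ((2 * n - k).choose n : ℝ) * (n.factorial ^ 2 / (2 * n).factorial) := by
  rw [rise_neg_natCast h, rise_neg_natCast (by omega), Nat.cast_choose ℝ (by omega),
    show 2 * n - k - n = n - k by omega]
  have h1 : ((2 * n - k).factorial : ℝ) ≠ 0 := by exact_mod_cast Nat.factorial_ne_zero _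
  have h2 : ((n - k).factorial : ℝ) ≠ 0 := by exact_mod_cast Nat.factorial_ne_zero _
  have h3 : ((2 * n).factorial : ℝ) ≠ 0 := by exact_mod_cast Nat.factorial_ne_zero _
  have h4 : (n.factorial : ℝ) ≠ 0 := by exact_mod_cast Nat.factorial_ne_zero _
  have h5 : (-1 : ℝ) ^ k ≠ 0 := by simp
  field_simp

theorem baileyDouble_eq (n : ℕ) (b₁ c₁ b₂ c₂ b₃ c₃ : ℝ) :
    baileyDouble (-n) b₁ c₁ b₂ c₂ b₃ c₃ n = ∑ i ∈ range (n + 1), ∑ j ∈ Icc i n,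
      (rise (1 + -n - b₃) n * rise (1 + -n - c₃) n)⁻¹
      * (rise b₃ j / rise (1 + -n - b₂) j * (rise c₃ j / rise (1 + -n - c₂) j))
      * (rise (1 + -n - b₃ - c₃) (n - j) / (n - j).factorial)
      * (rise b₂ i / rise (1 + -n - b₁) i * (rise c₂ i / rise (1 + -n - c₁) i))
      * (rise (1 + -n - b₂ - c₂) (j - i) / (j - i).factorial)
      * (rise (1 + -n - b₁ - c₁) i / i.factorial) := by
  rw [baileyDouble]
  simp only [mul_sum]
  rw [sum_comm' (t' := range (n + 1)) (s' := fun i => Icc i n)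
    (by intro x y; simp only [mem_range, mem_Icc]; omega)]
  exact sum_congr rfl fun i _ => sum_congr rfl fun j _ => by ring

/-- At `e = 0` a pair contributes through `1 + a - b - c`, which is `n + 1`, `-n` or `-(3n+1)` when
it contains no, one or two parameters `n + 1`. With both in the first pair, `C(3n+1, ·)` has lower
index `i`; the second and third pairs give `j - i` and `n - j`. -/
theorem neg_sum_deriv_wellPoised_eq_choose_three_mul_add_one_left (n : ℕ) :
    -∑ l ∈ range (n + 1), deriv (wellPoised n l) 0
      = (-1 : ℝ) ^ n * ∑ i ∈ Finset.range (n + 1),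
          (-1 : ℝ) ^ i * ((3 * n + 1).choose i : ℝ) * ((2 * n - i).choose n : ℝ) ^ 2 *
            ∑ j ∈ Finset.Icc i n,
              ((n + j - i).choose n : ℝ) * (n.choose j : ℝ) ^ 2 * ((2 * n - j).choose n : ℝ) := by
  rw [neg_sum_deriv_wellPoised n (b₁ := (n + 1)) (c₁ := (n + 1)) (b₂ := (-n)) (c₂ := (-n))
    (b₃ := (-n)) (c₃ := (-n)) (by intro x hx; simp at hx; tauto) (by intro g; ring),
    baileyDouble_eq]
  simp only [mul_sum]
  refine sum_congr rfl fun i hi => sum_congr rfl fun j hj => ?_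
  obtain ⟨hij, hjn⟩ := mem_Icc.1 hj
  have e1 : (1 : ℝ) + -n - -n = 1 := by ring
  have e2 : (1 : ℝ) + -n - (n + 1) = -(2 * n : ℕ) := by push_cast; ring
  have e3 : (1 : ℝ) - -n = n + 1 := by ring
  have e4 : (1 : ℝ) - (n + 1) = -n := by ring
  have e5 : -((2 * n : ℕ) : ℝ) - (n + 1) = -(3 * n + 1 : ℕ) := by push_cast; ring
  have e6 : -((2 * n : ℕ) : ℝ) - -n = -n := by push_cast; ring
  simp only [e1, e2, e3, e4, e5, e6, rise_one, rise_div_factorial, rise_neg_div_factorial hjn,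
    rise_neg_div_factorial (hij.trans hjn), rise_neg_div_rise_neg hjn,
    rise_neg_div_rise_neg (hij.trans hjn), rise_neg_natCast (show n ≤ 2 * n by omega),
    rise_neg_div_factorial (show j - i ≤ n by omega),
    rise_neg_div_factorial (show n - j ≤ n by omega),
    rise_neg_div_factorial (show j - i ≤ 3 * n + 1 by omega),
    rise_neg_div_factorial (show n - j ≤ 3 * n + 1 by omega),
    rise_neg_div_factorial (show i ≤ 3 * n + 1 by omega), Nat.choose_symm hjn,
    show n + (n - j) = 2 * n - j by omega, show n + (j - i) = n + j - i by omega,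
    show 2 * n - n = n by omega]
  have h1 : ((2 * n).factorial : ℝ) ≠ 0 := by exact_mod_cast Nat.factorial_ne_zero _
  have h2 : (n.factorial : ℝ) ≠ 0 := by exact_mod_cast Nat.factorial_ne_zero _
  have s1 : (-1 : ℝ) ^ j = (-1) ^ i * (-1) ^ (j - i) := by rw [← pow_add, Nat.add_sub_cancel' hij]
  have s2 : (-1 : ℝ) ^ n = (-1) ^ j * (-1) ^ (n - j) := by rw [← pow_add, Nat.add_sub_cancel' hjn]
  -- All signs are expressed through the three independent ones with exponents `i`, `j - i`, `n -
  -- j`.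
  rw [s2, s1]
  have t1 := neg_one_pow_eq_or ℝ i
  have t2 := neg_one_pow_eq_or ℝ (j - i)
  have t3 := neg_one_pow_eq_or ℝ (n - j)
  have t4 : (-1 : ℝ) ^ i ≠ 0 := by simp
  have t5 : (-1 : ℝ) ^ (j - i) ≠ 0 := by simp
  have t6 : (-1 : ℝ) ^ (n - j) ≠ 0 := by simp
  generalize (-1 : ℝ) ^ i = a at *
  generalize (-1 : ℝ) ^ (j - i) = b at *
  generalize (-1 : ℝ) ^ (n - j) = c at *
  field_simp
  rcases t1 with rfl | rfl <;> rcases t2 with rfl | rfl <;> rcases t3 with rfl | rfl <;> ring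

theorem neg_sum_deriv_wellPoised_eq_choose_three_mul_add_one_middle (n : ℕ) :
    -∑ l ∈ range (n + 1), deriv (wellPoised n l) 0
      = (-1 : ℝ) ^ n * ∑ i ∈ Finset.range (n + 1),
          (-1 : ℝ) ^ i * ((n + i).choose n : ℝ) ^ 3 *
            ∑ j ∈ Finset.Icc i n,
              (-1 : ℝ) ^ j * ((3 * n + 1).choose (j - i) : ℝ) * ((2 * n - j).choose n : ℝ) ^ 3 := by
  rw [neg_sum_deriv_wellPoised n (b₁ := (-n)) (c₁ := (-n)) (b₂ := (n + 1)) (c₂ := (n + 1))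
    (b₃ := (-n)) (c₃ := (-n)) (by intro x hx; simp at hx; tauto) (by intro g; ring),
    baileyDouble_eq]
  simp only [mul_sum]
  refine sum_congr rfl fun i hi => sum_congr rfl fun j hj => ?_
  obtain ⟨hij, hjn⟩ := mem_Icc.1 hj
  have e1 : (1 : ℝ) + -n - -n = 1 := by ring
  have e2 : (1 : ℝ) + -n - (n + 1) = -(2 * n : ℕ) := by push_cast; ring
  have e3 : (1 : ℝ) - -n = n + 1 := by ring
  have e4 : (1 : ℝ) - (n + 1) = -n := by ring
  have e5 : -((2 * n : ℕ) : ℝ) - (n + 1) = -(3 * n + 1 : ℕ) := by push_cast; ring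
  have e6 : -((2 * n : ℕ) : ℝ) - -n = -n := by push_cast; ring
  simp only [e1, e2, e3, e4, e5, e6, rise_one, rise_div_factorial, rise_neg_div_factorial hjn,
    rise_neg_div_factorial (hij.trans hjn), rise_neg_div_rise_neg hjn,
    rise_neg_div_rise_neg (hij.trans hjn), rise_neg_natCast (show n ≤ 2 * n by omega),
    rise_neg_div_factorial (show j - i ≤ n by omega),
    rise_neg_div_factorial (show n - j ≤ n by omega),
    rise_neg_div_factorial (show j - i ≤ 3 * n + 1 by omega),
    rise_neg_div_factorial (show n - j ≤ 3 * n + 1 by omega),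
    rise_neg_div_factorial (show i ≤ 3 * n + 1 by omega), Nat.choose_symm hjn,
    show n + (n - j) = 2 * n - j by omega, show n + (j - i) = n + j - i by omega,
    show 2 * n - n = n by omega]
  have h1 : ((2 * n).factorial : ℝ) ≠ 0 := by exact_mod_cast Nat.factorial_ne_zero _
  have h2 : (n.factorial : ℝ) ≠ 0 := by exact_mod_cast Nat.factorial_ne_zero _
  have s1 : (-1 : ℝ) ^ j = (-1) ^ i * (-1) ^ (j - i) := by rw [← pow_add, Nat.add_sub_cancel' hij]
  have s2 : (-1 : ℝ) ^ n = (-1) ^ j * (-1) ^ (n - j) := by rw [← pow_add, Nat.add_sub_cancel' hjn]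
  rw [s2, s1]
  have t1 := neg_one_pow_eq_or ℝ i
  have t2 := neg_one_pow_eq_or ℝ (j - i)
  have t3 := neg_one_pow_eq_or ℝ (n - j)
  have t4 : (-1 : ℝ) ^ i ≠ 0 := by simp
  have t5 : (-1 : ℝ) ^ (j - i) ≠ 0 := by simp
  have t6 : (-1 : ℝ) ^ (n - j) ≠ 0 := by simp
  generalize (-1 : ℝ) ^ i = a at *
  generalize (-1 : ℝ) ^ (j - i) = b at *
  generalize (-1 : ℝ) ^ (n - j) = c at *
  field_simp
  rcases t1 with rfl | rfl <;> rcases t2 with rfl | rfl <;> rcases t3 with rfl | rfl <;> ring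

theorem neg_sum_deriv_wellPoised_eq_choose_three_mul_add_one_right (n : ℕ) :
    -∑ l ∈ range (n + 1), deriv (wellPoised n l) 0
      = ∑ i ∈ Finset.range (n + 1),
          (n.choose i : ℝ) ^ 2 * ((n + i).choose n : ℝ) *
            ∑ j ∈ Finset.Icc i n,
              (-1 : ℝ) ^ j * ((n + j - i).choose n : ℝ) * ((n + j).choose n : ℝ) ^ 2 *
                ((3 * n + 1).choose (n - j) : ℝ) := by
  rw [neg_sum_deriv_wellPoised n (b₁ := (-n)) (c₁ := (-n)) (b₂ := (-n)) (c₂ := (-n))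
    (b₃ := (n + 1)) (c₃ := (n + 1)) (by intro x hx; simp at hx; tauto) (by intro g; ring),
    baileyDouble_eq]
  simp only [mul_sum]
  refine sum_congr rfl fun i hi => sum_congr rfl fun j hj => ?_
  obtain ⟨hij, hjn⟩ := mem_Icc.1 hj
  have e1 : (1 : ℝ) + -n - -n = 1 := by ring
  have e2 : (1 : ℝ) + -n - (n + 1) = -(2 * n : ℕ) := by push_cast; ring
  have e3 : (1 : ℝ) - -n = n + 1 := by ring
  have e4 : (1 : ℝ) - (n + 1) = -n := by ring
  have e5 : -((2 * n : ℕ) : ℝ) - (n + 1) = -(3 * n + 1 : ℕ) := by push_cast; ring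
  have e6 : -((2 * n : ℕ) : ℝ) - -n = -n := by push_cast; ring
  simp only [e1, e2, e3, e4, e5, e6, rise_one, rise_div_factorial, rise_neg_div_factorial hjn,
    rise_neg_div_factorial (hij.trans hjn), rise_neg_div_rise_neg hjn,
    rise_neg_div_rise_neg (hij.trans hjn), rise_neg_natCast (show n ≤ 2 * n by omega),
    rise_neg_div_factorial (show j - i ≤ n by omega),
    rise_neg_div_factorial (show n - j ≤ n by omega),
    rise_neg_div_factorial (show j - i ≤ 3 * n + 1 by omega),
    rise_neg_div_factorial (show n - j ≤ 3 * n + 1 by omega),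
    rise_neg_div_factorial (show i ≤ 3 * n + 1 by omega), Nat.choose_symm hjn,
    show n + (n - j) = 2 * n - j by omega, show n + (j - i) = n + j - i by omega,
    show 2 * n - n = n by omega]
  have h1 : ((2 * n).factorial : ℝ) ≠ 0 := by exact_mod_cast Nat.factorial_ne_zero _
  have h2 : (n.factorial : ℝ) ≠ 0 := by exact_mod_cast Nat.factorial_ne_zero _
  have s1 : (-1 : ℝ) ^ j = (-1) ^ i * (-1) ^ (j - i) := by rw [← pow_add, Nat.add_sub_cancel' hij]
  have s2 : (-1 : ℝ) ^ n = (-1) ^ j * (-1) ^ (n - j) := by rw [← pow_add, Nat.add_sub_cancel' hjn]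
  rw [s2, s1]
  have t1 := neg_one_pow_eq_or ℝ i
  have t2 := neg_one_pow_eq_or ℝ (j - i)
  have t3 := neg_one_pow_eq_or ℝ (n - j)
  have t4 : (-1 : ℝ) ^ i ≠ 0 := by simp
  have t5 : (-1 : ℝ) ^ (j - i) ≠ 0 := by simp
  have t6 : (-1 : ℝ) ^ (n - j) ≠ 0 := by simp
  generalize (-1 : ℝ) ^ i = a at *
  generalize (-1 : ℝ) ^ (j - i) = b at *
  generalize (-1 : ℝ) ^ (n - j) = c at *
  field_simp
  rcases t1 with rfl | rfl <;> rcases t2 with rfl | rfl <;> rcases t3 with rfl | rfl <;> ring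

/-- The two parameters `n + 1` are split between the first and second pairs, so no `C(3n+1, ·)`
occurs and all signs combine to `(-1)^n`. The order within pairs is chosen so that the ratios in
`baileyDouble` are binomial coefficients. -/
theorem neg_sum_deriv_wellPoised_eq_choose_sq_right (n : ℕ) :
    -∑ l ∈ range (n + 1), deriv (wellPoised n l) 0
      = (-1 : ℝ) ^ n * ∑ i ∈ Finset.range (n + 1),
          (n.choose i : ℝ) * ((n + i).choose n : ℝ) * ((2 * n - i).choose n : ℝ) *
            ∑ j ∈ Finset.Icc i n,
              (n.choose (j - i) : ℝ) * (n.choose j : ℝ) * ((2 * n - j).choose n : ℝ) ^ 2 := by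
  rw [neg_sum_deriv_wellPoised n (b₁ := (-n)) (c₁ := (n + 1)) (b₂ := (n + 1)) (c₂ := (-n))
    (b₃ := (-n)) (c₃ := (-n)) (by intro x hx; simp at hx; tauto) (by intro g; ring),
    baileyDouble_eq]
  simp only [mul_sum]
  refine sum_congr rfl fun i hi => sum_congr rfl fun j hj => ?_
  obtain ⟨hij, hjn⟩ := mem_Icc.1 hj
  have e1 : (1 : ℝ) + -n - -n = 1 := by ring
  have e2 : (1 : ℝ) + -n - (n + 1) = -(2 * n : ℕ) := by push_cast; ring
  have e3 : (1 : ℝ) - -n = n + 1 := by ring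
  have e4 : (1 : ℝ) - (n + 1) = -n := by ring
  have e5 : -((2 * n : ℕ) : ℝ) - (n + 1) = -(3 * n + 1 : ℕ) := by push_cast; ring
  have e6 : -((2 * n : ℕ) : ℝ) - -n = -n := by push_cast; ring
  simp only [e1, e2, e3, e4, e5, e6, rise_one, rise_div_factorial, rise_neg_div_factorial hjn,
    rise_neg_div_factorial (hij.trans hjn), rise_neg_div_rise_neg hjn,
    rise_neg_div_rise_neg (hij.trans hjn), rise_neg_natCast (show n ≤ 2 * n by omega),
    rise_neg_div_factorial (show j - i ≤ n by omega),
    rise_neg_div_factorial (show n - j ≤ n by omega),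
    rise_neg_div_factorial (show j - i ≤ 3 * n + 1 by omega),
    rise_neg_div_factorial (show n - j ≤ 3 * n + 1 by omega),
    rise_neg_div_factorial (show i ≤ 3 * n + 1 by omega), Nat.choose_symm hjn,
    show n + (n - j) = 2 * n - j by omega, show n + (j - i) = n + j - i by omega,
    show 2 * n - n = n by omega]
  have h1 : ((2 * n).factorial : ℝ) ≠ 0 := by exact_mod_cast Nat.factorial_ne_zero _
  have h2 : (n.factorial : ℝ) ≠ 0 := by exact_mod_cast Nat.factorial_ne_zero _
  have s1 : (-1 : ℝ) ^ j = (-1) ^ i * (-1) ^ (j - i) := by rw [← pow_add, Nat.add_sub_cancel' hij]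
  have s2 : (-1 : ℝ) ^ n = (-1) ^ j * (-1) ^ (n - j) := by rw [← pow_add, Nat.add_sub_cancel' hjn]
  rw [s2, s1]
  have t1 := neg_one_pow_eq_or ℝ i
  have t2 := neg_one_pow_eq_or ℝ (j - i)
  have t3 := neg_one_pow_eq_or ℝ (n - j)
  have t4 : (-1 : ℝ) ^ i ≠ 0 := by simp
  have t5 : (-1 : ℝ) ^ (j - i) ≠ 0 := by simp
  have t6 : (-1 : ℝ) ^ (n - j) ≠ 0 := by simp
  generalize (-1 : ℝ) ^ i = a at *
  generalize (-1 : ℝ) ^ (j - i) = b at *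
  generalize (-1 : ℝ) ^ (n - j) = c at *
  field_simp
  rcases t1 with rfl | rfl <;> rcases t2 with rfl | rfl <;> rcases t3 with rfl | rfl <;> ring

/-- The split is now between the second and third pairs. -/
theorem neg_sum_deriv_wellPoised_eq_choose_sq_left (n : ℕ) :
    -∑ l ∈ range (n + 1), deriv (wellPoised n l) 0
      = (-1 : ℝ) ^ n * ∑ i ∈ Finset.range (n + 1),
          (n.choose i : ℝ) * ((n + i).choose n : ℝ) ^ 2 *
            ∑ j ∈ Finset.Icc i n,
              (n.choose (j - i) : ℝ) * (n.choose j : ℝ) * ((n + j).choose n : ℝ) *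
                ((2 * n - j).choose n : ℝ) := by
  rw [neg_sum_deriv_wellPoised n (b₁ := (-n)) (c₁ := (-n)) (b₂ := (-n)) (c₂ := (n + 1))
    (b₃ := (n + 1)) (c₃ := (-n)) (by intro x hx; simp at hx; tauto) (by intro g; ring),
    baileyDouble_eq]
  simp only [mul_sum]
  refine sum_congr rfl fun i hi => sum_congr rfl fun j hj => ?_
  obtain ⟨hij, hjn⟩ := mem_Icc.1 hj
  have e1 : (1 : ℝ) + -n - -n = 1 := by ring
  have e2 : (1 : ℝ) + -n - (n + 1) = -(2 * n : ℕ) := by push_cast; ring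
  have e3 : (1 : ℝ) - -n = n + 1 := by ring
  have e4 : (1 : ℝ) - (n + 1) = -n := by ring
  have e5 : -((2 * n : ℕ) : ℝ) - (n + 1) = -(3 * n + 1 : ℕ) := by push_cast; ring
  have e6 : -((2 * n : ℕ) : ℝ) - -n = -n := by push_cast; ring
  simp only [e1, e2, e3, e4, e5, e6, rise_one, rise_div_factorial, rise_neg_div_factorial hjn,
    rise_neg_div_factorial (hij.trans hjn), rise_neg_div_rise_neg hjn,
    rise_neg_div_rise_neg (hij.trans hjn), rise_neg_natCast (show n ≤ 2 * n by omega),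
    rise_neg_div_factorial (show j - i ≤ n by omega),
    rise_neg_div_factorial (show n - j ≤ n by omega),
    rise_neg_div_factorial (show j - i ≤ 3 * n + 1 by omega),
    rise_neg_div_factorial (show n - j ≤ 3 * n + 1 by omega),
    rise_neg_div_factorial (show i ≤ 3 * n + 1 by omega), Nat.choose_symm hjn,
    show n + (n - j) = 2 * n - j by omega, show n + (j - i) = n + j - i by omega,
    show 2 * n - n = n by omega]
  have h1 : ((2 * n).factorial : ℝ) ≠ 0 := by exact_mod_cast Nat.factorial_ne_zero _
  have h2 : (n.factorial : ℝ) ≠ 0 := by exact_mod_cast Nat.factorial_ne_zero _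
  have s1 : (-1 : ℝ) ^ j = (-1) ^ i * (-1) ^ (j - i) := by rw [← pow_add, Nat.add_sub_cancel' hij]
  have s2 : (-1 : ℝ) ^ n = (-1) ^ j * (-1) ^ (n - j) := by rw [← pow_add, Nat.add_sub_cancel' hjn]
  rw [s2, s1]
  have t4 : (-1 : ℝ) ^ i ≠ 0 := by simp
  have t5 : (-1 : ℝ) ^ (j - i) ≠ 0 := by simp
  have t6 : (-1 : ℝ) ^ (n - j) ≠ 0 := by simp
  generalize (-1 : ℝ) ^ i = a at *
  generalize (-1 : ℝ) ^ (j - i) = b at *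
  generalize (-1 : ℝ) ^ (n - j) = c at *
  field_simp

/-! ### Initial values, integrality and identification with `u`. -/

/-- A double sum of natural numbers without inner signs: it makes the initial values computable and
shows that `u_n` is an integer. -/
theorem neg_sum_deriv_wellPoised_eq_natCast (n : ℕ) :
    -∑ l ∈ range (n + 1), deriv (wellPoised n l) 0
      = (-1) ^ n * ((∑ i ∈ range (n + 1), n.choose i * (n + i).choose n ^ 2
        * ∑ j ∈ Icc i n, n.choose (j - i) * n.choose j * (n + j).choose n
          * (2 * n - j).choose n : ℕ) : ℝ) := by
  rw [neg_sum_deriv_wellPoised_eq_choose_sq_left]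
  push_cast
  rfl

theorem neg_one_pow_mul_aperyZetaFour (n : ℕ) :
    (-1) ^ n * (aperyZetaFour n : ℝ) = -∑ l ∈ range (n + 1), deriv (wellPoised n l) 0 := by
  -- The certificate covers the recursion only for `m = k + 2 ≥ 2`, so the induction starts from the
  -- values at 1 and 2.
  have h : ∀ k, (-1) ^ (k + 1) * (aperyZetaFour (k + 1) : ℝ)
        = -∑ l ∈ range (k + 1 + 1), deriv (wellPoised (k + 1) l) 0 ∧
      (-1) ^ (k + 2) * (aperyZetaFour (k + 2) : ℝ)
        = -∑ l ∈ range (k + 2 + 1), deriv (wellPoised (k + 2) l) 0 := by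
    intro k
    induction k with
    | zero =>
      rw [neg_sum_deriv_wellPoised_eq_natCast, neg_sum_deriv_wellPoised_eq_natCast]
      constructor
      · rw [show (∑ i ∈ range (0 + 1 + 1), _ : ℕ) = 12 by decide +kernel]
        norm_num [aperyZetaFour]
      · rw [show (∑ i ∈ range (0 + 2 + 1), _ : ℕ) = 804 by decide +kernel]
        norm_num [aperyZetaFour]
    | succ k ih =>
      refine ⟨ih.2, ?_⟩
      have hs := sum_deriv_wellPoised_rec k
      have hu : (((_ : ℚ)) : ℝ) = ((0 : ℚ) : ℝ) :=
        congrArg (Rat.cast (K := ℝ)) (aperyZetaFour_rec (k + 2) (by omega))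
      rw [show k + 2 - 1 = k + 1 by omega, show k + 2 + 1 = k + 3 by omega] at hu
      push_cast at hu
      have i1 := ih.1
      have i2 := ih.2
      rw [show k + 1 + 2 = k + 3 by omega]
      have hp : ((k : ℝ) + 2 + 1) ^ 5 ≠ 0 := by positivity
      refine mul_left_cancel₀ hp ?_
      have t1 : (-1 : ℝ) ^ (k + 1) = -(-1) ^ k := by ring
      have t2 : (-1 : ℝ) ^ (k + 2) = (-1) ^ k := by ring
      have t3 : (-1 : ℝ) ^ (k + 3) = -(-1) ^ k := by ring
      rw [t1] at i1
      rw [t2] at i2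
      rw [t3]
      linear_combination (-(-1) ^ k) * hu + hs
        - 3 * (2 * ((k : ℝ) + 2) + 1) * (3 * ((k : ℝ) + 2) ^ 2 + 3 * ((k : ℝ) + 2) + 1)
          * (15 * ((k : ℝ) + 2) ^ 2 + 15 * ((k : ℝ) + 2) + 4) * i2
        + 3 * ((k : ℝ) + 2) ^ 3 * (3 * ((k : ℝ) + 2) - 1) * (3 * ((k : ℝ) + 2) + 1) * i1
  rcases n with _ | n
  · rw [neg_sum_deriv_wellPoised_eq_natCast]
    norm_num [aperyZetaFour]
  · exact (h n).1

end

theorem mainTheorem3 (n : ℕ) :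
    (∀ l ∈ Finset.range (n + 1), DifferentiableAt ℝ (zetaFourTerm n) (l : ℝ)) ∧
    (-1 : ℝ) ^ n * (aperyZetaFour n : ℝ)
      = -∑ l ∈ Finset.range (n + 1), deriv (zetaFourTerm n) (l : ℝ) ∧
    (-1 : ℝ) ^ n * (aperyZetaFour n : ℝ)
      = (-1 : ℝ) ^ n * ∑ i ∈ Finset.range (n + 1),
          (-1 : ℝ) ^ i * ((3 * n + 1).choose i : ℝ) * ((2 * n - i).choose n : ℝ) ^ 2 *
            ∑ j ∈ Finset.Icc i n,
              ((n + j - i).choose n : ℝ) * (n.choose j : ℝ) ^ 2 * ((2 * n - j).choose n : ℝ) ∧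
    (-1 : ℝ) ^ n * (aperyZetaFour n : ℝ)
      = (-1 : ℝ) ^ n * ∑ i ∈ Finset.range (n + 1),
          (-1 : ℝ) ^ i * ((n + i).choose n : ℝ) ^ 3 *
            ∑ j ∈ Finset.Icc i n,
              (-1 : ℝ) ^ j * ((3 * n + 1).choose (j - i) : ℝ) * ((2 * n - j).choose n : ℝ) ^ 3 ∧
    (-1 : ℝ) ^ n * (aperyZetaFour n : ℝ)
      = ∑ i ∈ Finset.range (n + 1),
          (n.choose i : ℝ) ^ 2 * ((n + i).choose n : ℝ) *
            ∑ j ∈ Finset.Icc i n,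
              (-1 : ℝ) ^ j * ((n + j - i).choose n : ℝ) * ((n + j).choose n : ℝ) ^ 2 *
                ((3 * n + 1).choose (n - j) : ℝ) ∧
    (-1 : ℝ) ^ n * (aperyZetaFour n : ℝ)
      = (-1 : ℝ) ^ n * ∑ i ∈ Finset.range (n + 1),
          (n.choose i : ℝ) * ((n + i).choose n : ℝ) * ((2 * n - i).choose n : ℝ) *
            ∑ j ∈ Finset.Icc i n,
              (n.choose (j - i) : ℝ) * (n.choose j : ℝ) * ((2 * n - j).choose n : ℝ) ^ 2 ∧
    (-1 : ℝ) ^ n * (aperyZetaFour n : ℝ)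
      = (-1 : ℝ) ^ n * ∑ i ∈ Finset.range (n + 1),
          (n.choose i : ℝ) * ((n + i).choose n : ℝ) ^ 2 *
            ∑ j ∈ Finset.Icc i n,
              (n.choose (j - i) : ℝ) * (n.choose j : ℝ) * ((n + j).choose n : ℝ) *
                ((2 * n - j).choose n : ℝ) ∧
    ∃ z : ℤ, aperyZetaFour n = (z : ℚ) := by
  have h := neg_one_pow_mul_aperyZetaFour n
  refine ⟨fun l hl => (hasDerivAt_zetaFourTerm
    (Nat.lt_succ_iff.1 (Finset.mem_range.1 hl))).differentiableAt, ?_,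
    h.trans (neg_sum_deriv_wellPoised_eq_choose_three_mul_add_one_left n),
    h.trans (neg_sum_deriv_wellPoised_eq_choose_three_mul_add_one_middle n),
    h.trans (neg_sum_deriv_wellPoised_eq_choose_three_mul_add_one_right n),
    h.trans (neg_sum_deriv_wellPoised_eq_choose_sq_right n),
    h.trans (neg_sum_deriv_wellPoised_eq_choose_sq_left n), ?_⟩
  · rw [h]
    congr 1
    exact Finset.sum_congr rfl fun l hl =>
      (hasDerivAt_zetaFourTerm (Nat.lt_succ_iff.1 (Finset.mem_range.1 hl))).deriv.symm
  · rw [neg_sum_deriv_wellPoised_eq_natCast] at h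
    have h' := mul_left_cancel₀ (by simp) h
    exact ⟨_, by exact_mod_cast h'⟩
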